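/- Let $(x_1,y_1),\dots,(x_n,y_n)\in\mathbb R^2$ be arbitrary data, ties allowed. For $n\ge 4$ put $$t^*=\frac{(n-4)!}{n!}\sum_{i,j,k,l\ \text{distinct}}a(x_i,x_j,x_k,x_l)\,a(y_i,y_j,y_k,y_l),\qquad a(z_1,z_2,z_3,z_4)=\operatorname{sign}\bigl(|z_1-z_2|+|z_3-z_4|-|z_1-z_3|-|z_2-z_4|\bigr).$$ Four points, relabelled so that $x_1\le x_2\le x_3\le x_4$, are *inseparable* if $x_2=x_3$ or if $y_{\pi(1)}\le y_{\pi(2)}=y_{\pi(3)}\le y_{\pi(4)}$ for some permutation $\pi$. Otherwise they are *concordant* if $\max(y_1,y_2)<\min(y_3,y_4)$ or $\max(y_3,y_4)<\min(y_1,y_2)$, and *discordant* if $\max(y_1,y_2)>\min(y_3,y_4)$ and $\max(y_3,y_4)>\min(y_1,y_2)$. Call them *over-counted* if $x_2\ne x_3$, $y_1=y_2$ and $\min(y_3,y_4)<y_1<\max(y_3,y_4)$ (such points are inseparable). Let $N_c$, $N_d$, $N_o$ be the numbers of four-element sets of indices whose points are concordant, discordant, over-counted, respectively. Consider the following algorithm.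 1. Sort the points by $x$ (merge sort), so that $x_1\le\dots\le x_n$. Set $\mathit{con}=\mathit{dis}=0$, and start with an empty red-black tree whose nodes store subtree sizes and with an empty list of saved values. 2. First pass. For $k=1,\dots,n-1$: if $k\ne1$ and $x_{k-1}\ne x_k$, insert all saved values into the tree and empty the list; then add $y_k$ to the list. For $l=k+1,\dots,n$ let $m=\min(y_k,y_l)$, $M=\max(y_k,y_l)$, and let $\mathit{top},\mathit{mid},\mathit{bot},\mathit{eqMin},\mathit{eqMax}$ be the numbers of elements of the tree that are $>M$; $>m$ and $<M$; $<m$; $=m$; $=M$, respectively. Add $\binom{\mathit{top}}2+\binom{\mathit{bot}}2$ to $\mathit{con}$, and, if $m\ne M$, add to $\mathit{dis}$ $$\binom{\mathit{mid}}2+\mathit{top}\cdot\mathit{mid}+\mathit{top}\cdot\mathit{bot}+\mathit{mid}\cdot\mathit{bot}+\mathit{eqMin}\,(\mathit{top}+\mathit{mid}+\mathit{eqMax})+\mathit{eqMax}\,(\mathit{mid}+\mathit{bot}).$$ 3. Second pass. Start again with an empty tree and an empty list. For $j=n,\dots,2$: if $j\ne n$ and $x_{j+1}\ne x_j$, insert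 all saved values into the tree and empty the list; then add $y_j$ to the list. For $i=j-1,\dots,1$ let $\mathit{top}$ and $\mathit{bot}$ be the numbers of elements of the tree that are $>\max(y_i,y_j)$ and $<\min(y_i,y_j)$; if $y_i=y_j$, subtract $\mathit{top}\cdot\mathit{bot}$ from $\mathit{dis}$. 4. Return $\frac{1}{n(n-1)(n-2)(n-3)}(16\,\mathit{con}-8\,\mathit{dis})$. Then: (a) for all $n\ge4$ and all data the algorithm returns exactly $t^*$; (b) it runs in $O(n^2\log n)$ time: there is an absolute constant $C$ such that for all $n\ge2$ and all data it performs at most $C\,n^2\log n$ elementary steps, where a procedure call, a comparison of two numbers, an arithmetic operation, a conversion between number types and the creation of a list cell each count as one step (sorting, tree insertions with rebalancing, and tree queries are broken down into such steps); (c) after the first pass $\mathit{con}=N_c$ and $\mathit{dis}=N_d+N_o$; (d) the second pass subtracts exactly $N_o$ from $\mathit{dis}$. -/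

import Mathlib

namespace TauStar

/-! ### The statistic -/

/-- `a(z₁,z₂,z₃,z₄) = sign(|z₁-z₂| + |z₃-z₄| - |z₁-z₃| - |z₂-z₄|)`. -/
noncomputable def a (z₁ z₂ z₃ z₄ : ℝ) : ℝ :=
  Real.sign (|z₁ - z₂| + |z₃ - z₄| - |z₁ - z₃| - |z₂ - z₄|)

/-- The U-statistic `t*`; an embedding `e : Fin 4 ↪ Fin n` is a quadruple
`(e 0, e 1, e 2, e 3)` of pairwise distinct indices. -/
noncomputable def tStar {n : ℕ} (x y : Fin n → ℝ) : ℝ :=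
  ((n - 4).factorial : ℝ) / (n.factorial : ℝ) *
    ∑ e : Fin 4 ↪ Fin n,
      a (x (e 0)) (x (e 1)) (x (e 2)) (x (e 3)) * a (y (e 0)) (y (e 1)) (y (e 2)) (y (e 3))

/-! ### Concordant and discordant quadruples -/

/-- `e` relabels the set `S` of indices such that the first coordinates ascend. -/
def Labels {n : ℕ} (x : Fin n → ℝ) (S : Finset (Fin n)) (e : Fin 4 ↪ Fin n) : Prop :=
  Finset.univ.map e = S ∧
    x (e 0) ≤ x (e 1) ∧ x (e 1) ≤ x (e 2) ∧ x (e 2) ≤ x (e 3)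

/-- Inseparability of four points `(u i, v i)` with `u 0 ≤ u 1 ≤ u 2 ≤ u 3`. -/
def Inseparable (u v : Fin 4 → ℝ) : Prop :=
  u 1 = u 2 ∨ ∃ π : Equiv.Perm (Fin 4), v (π 0) ≤ v (π 1) ∧ v (π 1) = v (π 2) ∧ v (π 2) ≤ v (π 3)

/-- Concordance of four points `(u i, v i)` with `u 0 ≤ u 1 ≤ u 2 ≤ u 3`. -/
def Concordant (u v : Fin 4 → ℝ) : Prop :=
  ¬ Inseparable u v ∧
    (max (v 0) (v 1) < min (v 2) (v 3) ∨ max (v 2) (v 3) < min (v 0) (v 1))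

/-- Discordance of four points `(u i, v i)` with `u 0 ≤ u 1 ≤ u 2 ≤ u 3`. -/
def Discordant (u v : Fin 4 → ℝ) : Prop :=
  ¬ Inseparable u v ∧
    (max (v 0) (v 1) > min (v 2) (v 3) ∧ max (v 2) (v 3) > min (v 0) (v 1))

/-- Four points `(u i, v i)` with `u 0 ≤ u 1 ≤ u 2 ≤ u 3` whose two left points have the same
second coordinate, strictly between the second coordinates of the two right points. -/
def Overcounted (u v : Fin 4 → ℝ) : Prop :=
  u 1 ≠ u 2 ∧ v 0 = v 1 ∧ min (v 2) (v 3) < v 0 ∧ v 0 < max (v 2) (v 3)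

open Classical in
/-- The number of quadruples (four-element sets of indices) of the data which, relabelled by
ascending first coordinate, satisfy `P`. -/
noncomputable def numQuadruples (P : (Fin 4 → ℝ) → (Fin 4 → ℝ) → Prop) {n : ℕ}
    (x y : Fin n → ℝ) : ℕ :=
  ((Finset.powersetCard 4 (Finset.univ : Finset (Fin n))).filter
    (fun S => ∃ e : Fin 4 ↪ Fin n, Labels x S e ∧ P (x ∘ e) (y ∘ e))).card

/-! ### The cost model

A computation returns a value together with the number of elementary steps performed. The unit-cost
primitives below are: a procedure call (which includes inspecting the arguments by a fixed pattern),
a comparison (or minimum, maximum) of two numbers, an arithmetic operation, the conversion between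
number types, and the creation of one list cell. Sequencing adds the costs. All procedures after
this section, including sorting and the search tree, are built from these primitives by recursion. -/

/-- The result of a computation with the number of steps it took. -/
structure Timed (β : Type) where
  /-- the returned value -/
  val : β
  /-- the number of elementary steps -/
  cost : ℕ

namespace Timed

instance : Monad Timed where
  pure b := ⟨b, 0⟩
  bind m f := ⟨(f m.val).val, m.cost + (f m.val).cost⟩

/-- The call of a procedure. -/
def call : Timed Unit := ⟨(), 1⟩

/-- Is `s < t`? -/
def less {α : Type} [LinearOrder α] (s t : α) : Timed Bool := ⟨decide (s < t), 1⟩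

/-- Is `s = t`? -/
def equal {α : Type} [LinearOrder α] (s t : α) : Timed Bool := ⟨decide (s = t), 1⟩

/-- The smaller of two numbers. -/
def minimum {α : Type} [LinearOrder α] (s t : α) : Timed α := ⟨min s t, 1⟩

/-- The larger of two numbers. -/
def maximum {α : Type} [LinearOrder α] (s t : α) : Timed α := ⟨max s t, 1⟩

/-- Addition. -/
def add {R : Type} [Add R] (s t : R) : Timed R := ⟨s + t, 1⟩

/-- Subtraction (truncated at zero for natural numbers). -/
def sub {R : Type} [Sub R] (s t : R) : Timed R := ⟨s - t, 1⟩

/-- Multiplication. -/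
def mul {R : Type} [Mul R] (s t : R) : Timed R := ⟨s * t, 1⟩

/-- Division (rounding down for natural numbers). -/
def div {R : Type} [Div R] (s t : R) : Timed R := ⟨s / t, 1⟩

/-- Conversion of a natural number to an integer. -/
def natToInt (m : ℕ) : Timed ℤ := ⟨(m : ℤ), 1⟩

/-- Conversion of a natural number to a real number. -/
noncomputable def natToReal (m : ℕ) : Timed ℝ := ⟨(m : ℝ), 1⟩

/-- Conversion of an integer to a real number. -/
noncomputable def intToReal (m : ℤ) : Timed ℝ := ⟨(m : ℝ), 1⟩

/-- Creation of a list cell. -/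
def cons {β : Type} (b : β) (l : List β) : Timed (List β) := ⟨b :: l, 1⟩

end Timed

open Timed

/-! ### Lists and sorting -/

/-- The length of a list. -/
def length {β : Type} : List β → Timed ℕ
  | [] => do
      call
      return 0
  | _ :: l => do
      call
      let m ← length l
      add m 1

/-- Reversal of a list in front of an accumulator. -/
def reverseOnto {β : Type} : List β → List β → Timed (List β)
  | [], acc => do
      call
      return acc
  | b :: l, acc => do
      call
      let acc' ← cons b acc
      reverseOnto l acc'

/-- Merging of two lists of points that are sorted by first coordinate. -/
def merge {α : Type} [LinearOrder α] : List (α × α) → List (α × α) → Timed (List (α × α))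
  | [], r => do
      call
      return r
  | l, [] => do
      call
      return l
  | p :: l, q :: r => do
      call
      let b ← less q.1 p.1
      if b then do
        let m ← merge (p :: l) r
        cons q m
      else do
        let m ← merge l (q :: r)
        cons p m
termination_by l r => l.length + r.length

/-- Merge sort by first coordinate (each point keeps its second coordinate) of the first `m`
points of a list. The second component of the result is the remainder of the list. (The two lines
defining `h` and `h'` charge for computing the sizes of the two halves; the recursive calls spell
these sizes out so that termination is visible.) -/
def mergeSort {α : Type} [LinearOrder α] :
    ℕ → List (α × α) → Timed (List (α × α) × List (α × α))
  | 0, l => do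
      call
      return ([], l)
  | 1, [] => do
      call
      return ([], [])
  | 1, p :: l => do
      call
      let s ← cons p []
      return (s, l)
  | m + 2, l => do
      call
      let h ← div (m + 2) 2
      let h' ← sub (m + 2) h
      let s₁ ← mergeSort ((m + 2) / 2) l
      let s₂ ← mergeSort ((m + 2) - (m + 2) / 2) s₁.2
      let s ← merge s₁.1 s₂.1
      return (s, s₂.2)
termination_by m => m

/-- Sorting the whole list of points by first coordinate. -/
def sortPoints {α : Type} [LinearOrder α] (l : List (α × α)) : Timed (List (α × α)) := do
  call
  let n ← length l
  let s ← mergeSort n l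
  return s.1

/-! ### Red-black trees with subtree sizes -/

/-- The colour of a node. -/
inductive Color
  | red
  | black

/-- Red-black search trees. Each node stores its colour, its subtrees, its key and the number of
keys in the subtree below it (itself included). Equal keys may occur repeatedly. -/
inductive RBTree (α : Type)
  | nil : RBTree α
  | node (c : Color) (l : RBTree α) (key : α) (r : RBTree α) (size : ℕ) : RBTree α

namespace RBTree

variable {α : Type}

/-- Read off the number of keys. -/
def size : RBTree α → Timed ℕ
  | nil => do
      call
      return 0
  | node _ _ _ _ s => do
      call
      return s

/-- Create a node and compute its size field. -/
def mkNode (c : Color) (l : RBTree α) (key : α) (r : RBTree α) : Timed (RBTree α) := do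
  call
  let s₁ ← size l
  let s₂ ← size r
  let s ← add s₁ s₂
  let s' ← add s 1
  return node c l key r s'

/-- Create a node; if it is black and has a red child with a red child, rebalance. -/
def balance : Color → RBTree α → α → RBTree α → Timed (RBTree α)
  | .black, node .red (node .red t₁ k₁ t₂ _) k₂ t₃ _, k₃, t₄ => do
      call
      let l ← mkNode .black t₁ k₁ t₂
      let r ← mkNode .black t₃ k₃ t₄
      mkNode .red l k₂ r
  | .black, node .red t₁ k₁ (node .red t₂ k₂ t₃ _) _, k₃, t₄ => do
      call
      let l ← mkNode .black t₁ k₁ t₂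
      let r ← mkNode .black t₃ k₃ t₄
      mkNode .red l k₂ r
  | .black, t₁, k₁, node .red (node .red t₂ k₂ t₃ _) k₃ t₄ _ => do
      call
      let l ← mkNode .black t₁ k₁ t₂
      let r ← mkNode .black t₃ k₃ t₄
      mkNode .red l k₂ r
  | .black, t₁, k₁, node .red t₂ k₂ (node .red t₃ k₃ t₄ _) _ => do
      call
      let l ← mkNode .black t₁ k₁ t₂
      let r ← mkNode .black t₃ k₃ t₄
      mkNode .red l k₂ r
  | c, l, k, r => do
      call
      mkNode c l k r

/-- Insertion of a key at a leaf with rebalancing on the way back, before the root is recoloured. -/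
def insertAux [LinearOrder α] (v : α) : RBTree α → Timed (RBTree α)
  | nil => do
      call
      mkNode .red nil v nil
  | node c l key r _ => do
      call
      let b ← less v key
      if b then do
        let l' ← insertAux v l
        balance c l' key r
      else do
        let r' ← insertAux v r
        balance c l key r'

/-- Colour the root black. -/
def blackenRoot : RBTree α → Timed (RBTree α)
  | nil => do
      call
      return nil
  | node _ l key r s => do
      call
      return node .black l key r s

/-- Insertion of a key. -/
def insert [LinearOrder α] (v : α) (t : RBTree α) : Timed (RBTree α) := do
  call
  let t' ← insertAux v t
  blackenRoot t'

/-- Number of keys `< v`, found by following one path from the root. -/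
def countLess [LinearOrder α] (v : α) : RBTree α → Timed ℕ
  | nil => do
      call
      return 0
  | node _ l key r _ => do
      call
      let b ← less key v
      if b then do
        let s ← size l
        let m ← countLess v r
        let s' ← add s 1
        add s' m
      else
        countLess v l

/-- Number of keys `> v`, found by following one path from the root. -/
def countGreater [LinearOrder α] (v : α) : RBTree α → Timed ℕ
  | nil => do
      call
      return 0
  | node _ l key r _ => do
      call
      let b ← less v key
      if b then do
        let s ← size r
        let m ← countGreater v l
        let s' ← add s 1
        add s' m
      else
        countGreater v r

/-- Number of keys `= v`. -/
def countEqual [LinearOrder α] (v : α) (t : RBTree α) : Timed ℕ := do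
  call
  let s ← size t
  let m₁ ← countLess v t
  let m₂ ← countGreater v t
  let d ← sub s m₁
  sub d m₂

/-- Number of keys `> lo` and `< hi`, for `lo ≤ hi`. -/
def countBetween [LinearOrder α] (lo hi : α) (t : RBTree α) : Timed ℕ := do
  call
  let s ← size t
  let m₁ ← countLess hi t
  let m₂ ← countGreater lo t
  let d ← add m₁ m₂
  sub d s

end RBTree

/-! ### The algorithm -/

/-- `m choose 2`. -/
def chooseTwo (m : ℕ) : Timed ℕ := do
  call
  let m' ← sub m 1
  let d ← mul m m'
  div d 2

/-- Insert all saved values into the tree. -/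
def insertAll {α : Type} [LinearOrder α] : List α → RBTree α → Timed (RBTree α)
  | [], t => do
      call
      return t
  | v :: l, t => do
      call
      let t' ← RBTree.insert v t
      insertAll l t'

/-- Delayed insertion: if there is a previous point and its first coordinate differs from the
current one, insert all saved values into the tree and empty the list of saved values. -/
def release {α : Type} [LinearOrder α] (prev : Option α) (xk : α) (t : RBTree α)
    (saved : List α) : Timed (RBTree α × List α) :=
  match prev with
  | none => do
      call
      return (t, saved)
  | some x' => do
      call
      let b ← equal x' xk
      if b then
        return (t, saved)
      else do
        let t' ← insertAll saved t
        return (t', [])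

/-- `mid choose 2 + top * mid + top * bot + mid * bot + eqMin * (top + mid + eqMax) +
eqMax * (mid + bot)`. -/
def discordantTerm (top mid bot eqMin eqMax : ℕ) : Timed ℕ := do
  call
  let d₁ ← chooseTwo mid
  let d₂ ← mul top mid
  let d₃ ← mul top bot
  let d₄ ← mul mid bot
  let u ← add top mid
  let u' ← add u eqMax
  let d₅ ← mul eqMin u'
  let w ← add mid bot
  let d₆ ← mul eqMax w
  let s₂ ← add d₁ d₂
  let s₃ ← add s₂ d₃
  let s₄ ← add s₃ d₄
  let s₅ ← add s₄ d₅
  add s₅ d₆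

/-- Inner loop of the first pass: `yk` is the second coordinate of the current point, the list holds
the points after it, and `(con, dis)` are `(totalConcordant, totalDiscordant)`. -/
def firstInner {α : Type} [LinearOrder α] (t : RBTree α) (yk : α) :
    List (α × α) → ℤ → ℤ → Timed (ℤ × ℤ)
  | [], con, dis => do
      call
      return (con, dis)
  | p :: l, con, dis => do
      call
      let minY ← minimum yk p.2
      let maxY ← maximum yk p.2
      let top ← RBTree.countGreater maxY t
      let mid ← RBTree.countBetween minY maxY t
      let bot ← RBTree.countLess minY t
      let eqMin ← RBTree.countEqual minY t
      let eqMax ← RBTree.countEqual maxY t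
      let c₁ ← chooseTwo top
      let c₂ ← chooseTwo bot
      let c ← add c₁ c₂
      let c' ← natToInt c
      let con' ← add con c'
      let b ← equal minY maxY
      if b then
        firstInner t yk l con' dis
      else do
        let d ← discordantTerm top mid bot eqMin eqMax
        let d' ← natToInt d
        let dis' ← add dis d'
        firstInner t yk l con' dis'

/-- Outer loop of the first pass, over all points but the last. `prev` is the first coordinate of
the preceding point, if any. -/
def firstOuter {α : Type} [LinearOrder α] :
    List (α × α) → Option α → RBTree α → List α → ℤ → ℤ → Timed (ℤ × ℤ)
  | [], _, _, _, con, dis => do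
      call
      return (con, dis)
  | [_], _, _, _, con, dis => do
      call
      return (con, dis)
  | p :: q :: l, prev, t, saved, con, dis => do
      call
      let s ← release prev p.1 t saved
      let saved' ← cons p.2 s.2
      let r ← firstInner s.1 p.2 (q :: l) con dis
      firstOuter (q :: l) (some p.1) s.1 saved' r.1 r.2

/-- First pass, over a list sorted by first coordinate: returns
`(totalConcordant, totalDiscordant)`. -/
def firstPass {α : Type} [LinearOrder α] (l : List (α × α)) : Timed (ℤ × ℤ) := do
  call
  firstOuter l none RBTree.nil [] 0 0

/-- Inner loop of the second pass: the list holds the points before the current one, last first. -/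
def secondInner {α : Type} [LinearOrder α] (t : RBTree α) (yj : α) :
    List (α × α) → ℤ → Timed ℤ
  | [], dis => do
      call
      return dis
  | p :: l, dis => do
      call
      let minY ← minimum p.2 yj
      let maxY ← maximum p.2 yj
      let top ← RBTree.countGreater maxY t
      let bot ← RBTree.countLess minY t
      let b ← equal minY maxY
      if b then do
        let d ← mul top bot
        let d' ← natToInt d
        let dis' ← sub dis d'
        secondInner t yj l dis'
      else
        secondInner t yj l dis

/-- Outer loop of the second pass, over the reversed list of points without its last entry. `prev`
is the first coordinate of the point treated before, if any. -/
def secondOuter {α : Type} [LinearOrder α] :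
    List (α × α) → Option α → RBTree α → List α → ℤ → Timed ℤ
  | [], _, _, _, dis => do
      call
      return dis
  | [_], _, _, _, dis => do
      call
      return dis
  | p :: q :: l, prev, t, saved, dis => do
      call
      let s ← release prev p.1 t saved
      let saved' ← cons p.2 s.2
      let dis' ← secondInner s.1 p.2 (q :: l) dis
      secondOuter (q :: l) (some p.1) s.1 saved' dis'

/-- Second pass, over a list sorted by first coordinate, in reverse order: returns the corrected
value of `totalDiscordant`. -/
def secondPass {α : Type} [LinearOrder α] (l : List (α × α)) (dis : ℤ) : Timed ℤ := do
  call
  let r ← reverseOnto l []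
  secondOuter r none RBTree.nil [] dis

/-- `(16 * con - 8 * dis) / (n (n - 1) (n - 2) (n - 3))`. -/
noncomputable def combine (n : ℕ) (con dis : ℤ) : Timed ℝ := do
  call
  let n₀ ← natToReal n
  let n₁ ← sub n₀ 1
  let n₂ ← sub n₀ 2
  let n₃ ← sub n₀ 3
  let p₁ ← mul n₀ n₁
  let p₂ ← mul p₁ n₂
  let p₃ ← mul p₂ n₃
  let f ← div 1 p₃
  let c ← mul 16 con
  let d ← mul 8 dis
  let e ← sub c d
  let e' ← intToReal e
  mul f e'

/-- The whole algorithm. -/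
noncomputable def algorithm (data : List (ℝ × ℝ)) : Timed ℝ := do
  call
  let n ← length data
  let l ← sortPoints data
  let r ← firstPass l
  let dis ← secondPass l r.2
  combine n r.1 dis

/-- The data `(x₁,y₁), …, (xₙ,yₙ)` as the input list. -/
def points {n : ℕ} (x y : Fin n → ℝ) : List (ℝ × ℝ) :=
  List.ofFn fun i => (x i, y i)

end TauStar

/-! The value of `a` compares two of the three ways to split four numbers into two pairs. For
ascending `u` the sums of distances of the pairings 02|13 and 03|12 agree and exceed that of 01|23
by `2 * (u 2 - u 1)`. Summing the product over the 24 orders of four points therefore leaves `-8 *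
sign (u 2 - u 1) * pairingSign` (`sum_perm_a_mul_a`), and `pairingSign` is -2 for concordant second
coordinates, 1 for discordant ones and 0 otherwise (`pairingSign_eq`). So a concordant four-set
contributes 16 to the sum in `tStar` and a discordant one -8 (`tStar_eq`).

To count four-sets, take the points in sorted order and split by the last two, `p` and `q`
(`sum_powersetCard_four`). The other two must lie strictly to the left of `p`, and delayed insertion
keeps exactly the points strictly left of `p` in the tree (`State.holds_release`). The number of
suitable pairs of keys is a polynomial in a few counts, verified by adding one key at a time
(`sum_powersetCard_two`, `concordantCount_cons`, `discordantCount_cons`). The discordance test of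
the first pass also admits the over-counted four-sets and nothing else
(`discordantValues_or_overcountedValues`). The second pass uses the same scheme on the reversed
list, where `p` and `q` are the two leftmost points, and counts these alone. Sorting forgets the
indices, so four-sets of indices are replaced by multisets of points, in which coinciding points
keep their multiplicity (`numQuadruples_eq_sum`).

For the running time, the red-black invariants bound the depth by a multiple of the logarithm of the
size (`RBTree.Valid.depth_le`). Each inner step makes boundedly many queries, and the insertions in
one outer step cost no more in order of magnitude than its inner loop may. -/

namespace TauStar
open Timed

/-! ### Values and costs of the primitives. -/

namespace Timed

variable {β γ : Type}

@[simp] theorem val_bind (m : Timed β) (f : β → Timed γ) : (m >>= f).val = (f m.val).val := rfl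

@[simp] theorem cost_bind (m : Timed β) (f : β → Timed γ) :
    (m >>= f).cost = m.cost + (f m.val).cost := rfl

@[simp] theorem val_pure (b : β) : (pure b : Timed β).val = b := rfl
@[simp] theorem cost_pure (b : β) : (pure b : Timed β).cost = 0 := rfl
@[simp] theorem cost_call : call.cost = 1 := rfl

section
variable [LinearOrder β] (s t : β)
@[simp] theorem val_less : (less s t).val = decide (s < t) := rfl
@[simp] theorem cost_less : (less s t).cost = 1 := rfl
@[simp] theorem val_equal : (equal s t).val = decide (s = t) := rfl
@[simp] theorem cost_equal : (equal s t).cost = 1 := rfl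
@[simp] theorem val_minimum : (minimum s t).val = min s t := rfl
@[simp] theorem cost_minimum : (minimum s t).cost = 1 := rfl
@[simp] theorem val_maximum : (maximum s t).val = max s t := rfl
@[simp] theorem cost_maximum : (maximum s t).cost = 1 := rfl
end

@[simp] theorem val_add [Add β] (s t : β) : (add s t).val = s + t := rfl
@[simp] theorem cost_add [Add β] (s t : β) : (add s t).cost = 1 := rfl
@[simp] theorem val_sub [Sub β] (s t : β) : (sub s t).val = s - t := rfl
@[simp] theorem cost_sub [Sub β] (s t : β) : (sub s t).cost = 1 := rfl
@[simp] theorem val_mul [Mul β] (s t : β) : (mul s t).val = s * t := rfl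
@[simp] theorem cost_mul [Mul β] (s t : β) : (mul s t).cost = 1 := rfl
@[simp] theorem val_div [Div β] (s t : β) : (div s t).val = s / t := rfl
@[simp] theorem cost_div [Div β] (s t : β) : (div s t).cost = 1 := rfl
@[simp] theorem val_natToInt (m : ℕ) : (natToInt m).val = m := rfl
@[simp] theorem cost_natToInt (m : ℕ) : (natToInt m).cost = 1 := rfl
@[simp] theorem val_natToReal (m : ℕ) : (natToReal m).val = m := rfl
@[simp] theorem val_intToReal (m : ℤ) : (intToReal m).val = m := rfl
@[simp] theorem val_cons (b : β) (l : List β) : (cons b l).val = b :: l := rfl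
@[simp] theorem cost_cons (b : β) (l : List β) : (cons b l).cost = 1 := rfl

end Timed

/-! ### Search trees -/

namespace RBTree

variable {α : Type}

/-- The keys in order. -/
def toList : RBTree α → List α
  | nil => []
  | node _ l key r _ => toList l ++ key :: toList r

/-- All size fields hold the number of keys of their subtree. -/
def SizesCorrect : RBTree α → Prop
  | nil => True
  | node _ l _ r s =>
      SizesCorrect l ∧ SizesCorrect r ∧ s = l.toList.length + r.toList.length + 1

/-- The number of nodes on a longest path from the root. -/
def depth : RBTree α → ℕ
  | nil => 0
  | node _ l _ r _ => max (depth l) (depth r) + 1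

/-- The red-black invariants, with the colour of the root and the black height. -/
inductive Balanced : RBTree α → Color → ℕ → Prop
  | nil : Balanced nil .black 0
  | red {l r : RBTree α} {h : ℕ} (k : α) (s : ℕ) :
      Balanced l .black h → Balanced r .black h → Balanced (node .red l k r s) .red h
  | black {l r : RBTree α} {c c' : Color} {h : ℕ} (k : α) (s : ℕ) :
      Balanced l c h → Balanced r c' h → Balanced (node .black l k r s) .black (h + 1)

/-- The red-black invariants, except that a red root may have red children. -/
def AlmostBalanced (t : RBTree α) (h : ℕ) : Prop :=
  (∃ c, Balanced t c h) ∨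
    ∃ l k r s c c', t = node .red l k r s ∧ Balanced l c h ∧ Balanced r c' h

@[simp] theorem cost_size (t : RBTree α) : (size t).cost = 1 := by cases t <;> rfl

@[simp] theorem val_size_nil : (size (nil : RBTree α)).val = 0 := rfl

@[simp] theorem val_size_node (c : Color) (l : RBTree α) (k : α) (r : RBTree α) (s : ℕ) :
    (size (node c l k r s)).val = s := rfl

theorem SizesCorrect.val_size {t : RBTree α} (ht : t.SizesCorrect) :
    (size t).val = t.toList.length := by
  cases t with
  | nil => rfl
  | node c l k r s =>
    simp only [size, val_bind, val_pure, toList, List.length_append, List.length_cons, ht.2.2]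
    omega

@[simp] theorem val_mkNode (c : Color) (l : RBTree α) (k : α) (r : RBTree α) :
    (mkNode c l k r).val = node c l k r ((size l).val + (size r).val + 1) := rfl

@[simp] theorem cost_mkNode (c : Color) (l : RBTree α) (k : α) (r : RBTree α) :
    (mkNode c l k r).cost = 5 := by simp [mkNode]

/-- Rotations do not change the in-order sequence; contents and sortedness after rebalancing follow
from this alone. -/
theorem toList_balance (c : Color) (l : RBTree α) (k : α) (r : RBTree α) :
    (balance c l k r).val.toList = l.toList ++ k :: r.toList := by
  unfold balance
  split <;> simp [toList]

theorem cost_balance_le (c : Color) (l : RBTree α) (k : α) (r : RBTree α) :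
    -- One call and three nodes at cost 5.
    (balance c l k r).cost ≤ 16 := by
  unfold balance
  split <;> simp

theorem SizesCorrect.balance {l r : RBTree α} (hl : l.SizesCorrect) (hr : r.SizesCorrect)
    (c : Color) (k : α) : (balance c l k r).val.SizesCorrect := by
  unfold RBTree.balance
  split <;> simp_all [SizesCorrect, SizesCorrect.val_size, toList] <;> omega

/-- A red node is never rotated, so a red child may remain below it; the defect is passed up to the
parent. -/
theorem Balanced.balance_red {l r : RBTree α} {h : ℕ} {c c' : Color} (hl : Balanced l c h)
    (hr : Balanced r c' h) (k : α) : AlmostBalanced (balance .red l k r).val h := by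
  refine Or.inr ?_
  simp only [balance, val_bind, val_mkNode]
  exact ⟨_, _, _, _, _, _, rfl, hl, hr⟩

/-- Each rotation pattern contains a red node with a red child, which balanced subtrees exclude. -/
theorem Balanced.balance_black {l r : RBTree α} {h : ℕ} {c c' : Color} (hl : Balanced l c h)
    (hr : Balanced r c' h) (k : α) : ∃ d, Balanced (balance .black l k r).val d (h + 1) := by
  unfold balance
  split
  · obtain _ | ⟨_, _, ⟨⟩, _⟩ := hl
  · obtain _ | ⟨_, _, _, ⟨⟩⟩ := hl
  · obtain _ | ⟨_, _, ⟨⟩, _⟩ := hr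
  · obtain _ | ⟨_, _, _, ⟨⟩⟩ := hr
  · exact ⟨_, .black _ _ hl hr⟩

/-- The only possible defect, a red root with a red child, is one of the rotation patterns. The
rotation yields a red root above two black nodes, with the black height of an ordinary black node.
-/
theorem AlmostBalanced.balance_left {l r : RBTree α} {h : ℕ} {c : Color}
    (hl : AlmostBalanced l h) (hr : Balanced r c h) (k : α) :
    ∃ c', Balanced (balance .black l k r).val c' (h + 1) := by
  obtain ⟨c', hl⟩ | ⟨l', k', r', s, c₁, c₂, rfl, h₁, h₂⟩ := hl
  · exact hl.balance_black hr k
  · cases h₁ with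
    | red _ _ h₃ h₄ => exact ⟨_, .red _ _ (.black _ _ h₃ h₄) (.black _ _ h₂ hr)⟩
    | nil =>
      cases h₂ with
      | red _ _ h₃ h₄ => exact ⟨_, .red _ _ (.black _ _ .nil h₃) (.black _ _ h₄ hr)⟩
      | nil => exact (Balanced.red k' s .nil .nil).balance_black hr k
    | black _ _ h₃ h₄ =>
      cases h₂ with
      | red _ _ h₅ h₆ => exact ⟨_, .red _ _ (.black _ _ (.black _ _ h₃ h₄) h₅) (.black _ _ h₆ hr)⟩
      | black _ _ h₅ h₆ =>
        exact (Balanced.red k' s (.black _ _ h₃ h₄) (.black _ _ h₅ h₆)).balance_black hr k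

theorem AlmostBalanced.balance_right {l r : RBTree α} {h : ℕ} {c : Color}
    (hl : Balanced l c h) (hr : AlmostBalanced r h) (k : α) :
    ∃ c', Balanced (balance .black l k r).val c' (h + 1) := by
  obtain ⟨c', hr⟩ | ⟨l', k', r', s, c₁, c₂, rfl, h₁, h₂⟩ := hr
  · exact hl.balance_black hr k
  by_cases hc : c₁ = .black ∧ c₂ = .black
  · obtain ⟨rfl, rfl⟩ := hc
    exact hl.balance_black (.red k' s h₁ h₂) k
  -- The patterns for the left subtree are tried before those for the right one, so they have to be
  -- refuted from `hl`.
  unfold balance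
  split
  · obtain _ | ⟨_, _, ⟨⟩, _⟩ := hl
  · obtain _ | ⟨_, _, _, ⟨⟩⟩ := hl
  · rename_i e
    obtain ⟨-, rfl, rfl, rfl, rfl⟩ := node.inj e
    obtain _ | ⟨_, _, h₃, h₄⟩ := h₁
    exact ⟨_, .red _ _ (.black _ _ hl h₃) (.black _ _ h₄ h₂)⟩
  · rename_i e
    obtain ⟨-, rfl, rfl, rfl, rfl⟩ := node.inj e
    obtain _ | ⟨_, _, h₃, h₄⟩ := h₂
    exact ⟨_, .red _ _ (.black _ _ hl h₁) (.black _ _ h₃ h₄)⟩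
  -- No pattern matched, so both children are black, against `hc`.
  · rename_i e₁ e₂
    refine absurd ⟨?_, ?_⟩ hc
    · cases h₁ with
      | red => exact (e₁ _ _ _ _ _ _ _ rfl rfl).elim
      | _ => rfl
    · cases h₂ with
      | red => exact (e₂ _ _ _ _ _ _ _ rfl rfl).elim
      | _ => rfl

theorem Balanced.almostBalanced {t : RBTree α} {c : Color} {h : ℕ} (ht : Balanced t c h) :
    AlmostBalanced t h := Or.inl ⟨c, ht⟩

@[simp] theorem toList_blackenRoot (t : RBTree α) : (blackenRoot t).val.toList = t.toList := by
  cases t <;> rfl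

/-- Children of red nodes are black, so at most every second node of a path is red; only a red root
costs the extra 1. -/
theorem Balanced.depth_le {t : RBTree α} {c : Color} {h : ℕ} (ht : Balanced t c h) :
    t.depth ≤ 2 * h + 1 ∧ (c = .black → t.depth ≤ 2 * h) := by
  induction ht with
  | nil => simp [depth]
  | red k s hl hr ihl ihr =>
    have := ihl.2 rfl
    have := ihr.2 rfl
    simp only [depth, reduceCtorEq, false_implies, and_true]
    omega
  | black k s hl hr ihl ihr =>
    simp only [depth]
    omega

theorem Balanced.two_pow_le {t : RBTree α} {c : Color} {h : ℕ} (ht : Balanced t c h) :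
    2 ^ h ≤ t.toList.length + 1 := by
  induction ht with
  | nil => simp [toList]
  | red k s hl hr ihl ihr =>
    simp only [toList, List.length_append, List.length_cons]
    omega
  | black k s hl hr ihl ihr =>
    simp only [toList, List.length_append, List.length_cons, pow_succ]
    omega

section
variable [LinearOrder α]

/-- A red node with a red child can survive only at the root, and only if the root was red before.
The second conjunct is what the induction needs at a red node, whose children are black. -/
theorem Balanced.insertAux {t : RBTree α} {c : Color} {h : ℕ} (ht : Balanced t c h) (v : α) :
    AlmostBalanced (insertAux v t).val h ∧
      (c = .black → ∃ c', Balanced (RBTree.insertAux v t).val c' h) := by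
  induction ht with
  | nil =>
    have : Balanced (RBTree.insertAux v RBTree.nil).val .red 0 := by
      simp only [RBTree.insertAux, val_bind, val_mkNode]
      exact .red _ _ .nil .nil
    exact ⟨this.almostBalanced, fun _ => ⟨_, this⟩⟩
  | red k s hl hr ihl ihr =>
    simp only [RBTree.insertAux, val_bind, val_less, decide_eq_true_eq, reduceCtorEq,
      false_implies, and_true]
    split
    · exact (ihl.2 rfl).choose_spec.balance_red hr k
    · exact hl.balance_red (ihr.2 rfl).choose_spec k
  | @black l r c c' h k s hl hr ihl ihr =>
    have : ∃ d, Balanced (RBTree.insertAux v (node .black l k r s)).val d (h + 1) := by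
      simp only [RBTree.insertAux, val_bind, val_less, decide_eq_true_eq]
      split
      · exact ihl.1.balance_left hr k
      · exact AlmostBalanced.balance_right hl ihr.1 k
    exact ⟨Or.inl this, fun _ => this⟩

/-- Blackening the root removes the one permitted defect and keeps all paths at equal black height.
-/
theorem Balanced.insert {t : RBTree α} {c : Color} {h : ℕ} (ht : Balanced t c h) (v : α) :
    ∃ c' h', Balanced (insert v t).val c' h' := by
  simp only [RBTree.insert, val_bind]
  obtain ⟨c', h'⟩ | ⟨l, k, r, s, c₁, c₂, e, hl, hr⟩ := (ht.insertAux v).1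
  · generalize (RBTree.insertAux v t).val = t' at *
    cases h' with
    | nil => exact ⟨_, _, .nil⟩
    | red k s hl hr => exact ⟨_, _, .black k s hl hr⟩
    | black k s hl hr => exact ⟨_, _, .black k s hl hr⟩
  · rw [e]
    exact ⟨_, _, .black k s hl hr⟩

/-! ### Contents, order and size fields under insertion. -/

theorem toList_insertAux_perm (v : α) (t : RBTree α) :
    (insertAux v t).val.toList.Perm (v :: t.toList) := by
  induction t with
  | nil => simp [insertAux, toList]
  | node c l k r s ihl ihr =>
    simp only [insertAux, val_bind, val_less, decide_eq_true_eq]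
    split
    · simp only [val_bind, toList_balance, toList]
      exact ihl.append_right _
    · simp only [val_bind, toList_balance, toList]
      exact ((ihr.cons k).append_left _).trans
        (((List.Perm.swap v k _).append_left _).trans List.perm_middle)

theorem toList_insert_perm (v : α) (t : RBTree α) :
    (insert v t).val.toList.Perm (v :: t.toList) := by
  simpa [insert] using toList_insertAux_perm v t

theorem pairwise_insertAux (v : α) (t : RBTree α) (ht : t.toList.Pairwise (· ≤ ·)) :
    (insertAux v t).val.toList.Pairwise (· ≤ ·) := by
  induction t with
  | nil => simp [insertAux, toList]
  | node c l k r s ihl ihr =>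
    simp only [toList, List.pairwise_append, List.pairwise_cons, List.mem_cons] at ht
    obtain ⟨hl, ⟨hkr, hr⟩, hlr⟩ := ht
    simp only [insertAux, val_bind, val_less, decide_eq_true_eq]
    split
    · rename_i hv
      simp only [val_bind, toList_balance, List.pairwise_append, List.pairwise_cons]
      refine ⟨ihl hl, ⟨hkr, hr⟩, fun p hp q hq => ?_⟩
      rcases List.mem_cons.1 ((toList_insertAux_perm v l).mem_iff.1 hp) with rfl | hp
      · rcases List.mem_cons.1 hq with rfl | hq
        · exact hv.le
        · exact hv.le.trans (hkr _ hq)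
      · exact hlr p hp q (List.mem_cons.1 hq)
    · rename_i hv
      simp only [val_bind, toList_balance, List.pairwise_append, List.pairwise_cons]
      refine ⟨hl, ⟨fun q hq => ?_, ihr hr⟩, fun p hp q hq => ?_⟩
      · rcases List.mem_cons.1 ((toList_insertAux_perm v r).mem_iff.1 hq) with rfl | hq
        · exact not_lt.1 hv
        · exact hkr q hq
      · rcases List.mem_cons.1 hq with rfl | hq
        · exact hlr p hp _ (Or.inl rfl)
        rcases List.mem_cons.1 ((toList_insertAux_perm v r).mem_iff.1 hq) with rfl | hq
        · exact (hlr p hp _ (Or.inl rfl)).trans (not_lt.1 hv)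
        · exact hlr p hp q (Or.inr hq)

theorem SizesCorrect.insertAux {t : RBTree α} (ht : t.SizesCorrect) (v : α) :
    (insertAux v t).val.SizesCorrect := by
  induction t with
  | nil => simp [RBTree.insertAux, SizesCorrect, size, toList]
  | node c l k r s ihl ihr =>
    simp only [RBTree.insertAux, val_bind, val_less, decide_eq_true_eq]
    split
    · exact (ihl ht.1).balance ht.2.1 c k
    · exact ht.1.balance (ihr ht.2.1) c k

theorem SizesCorrect.insert {t : RBTree α} (ht : t.SizesCorrect) (v : α) :
    (insert v t).val.SizesCorrect := by
  have := ht.insertAux v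
  simp only [RBTree.insert, val_bind]
  generalize (RBTree.insertAux v t).val = t' at *
  cases t' <;> exact this

/-- A red-black search tree with correct size fields. -/
structure Valid (t : RBTree α) : Prop where
  sizes : t.SizesCorrect
  sorted : t.toList.Pairwise (· ≤ ·)
  balanced : ∃ c h, Balanced t c h

theorem valid_nil : (nil : RBTree α).Valid := ⟨trivial, .nil, _, _, .nil⟩

theorem Valid.insert {t : RBTree α} (ht : t.Valid) (v : α) : (insert v t).val.Valid := by
  obtain ⟨c, h, hb⟩ := ht.balanced
  refine ⟨ht.sizes.insert v, ?_, hb.insert v⟩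
  simpa [RBTree.insert] using pairwise_insertAux v t ht.sorted

/-- By sortedness, `key < v` makes the whole left subtree count, so its size field suffices;
otherwise nothing in the right subtree counts. -/
theorem val_countLess (v : α) {t : RBTree α} (hs : t.SizesCorrect)
    (ht : t.toList.Pairwise (· ≤ ·)) :
    (countLess v t).val = t.toList.countP (· < v) := by
  induction t with
  | nil => rfl
  | node c l k r s ihl ihr =>
    simp only [toList, List.pairwise_append, List.pairwise_cons, List.mem_cons] at ht
    obtain ⟨hl, ⟨hkr, hr⟩, hlr⟩ := ht
    simp only [countLess, val_bind, val_less, decide_eq_true_eq, toList, List.countP_append,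
      List.countP_cons]
    split
    · rename_i hv
      simp only [val_bind, val_add, hs.1.val_size, ihr hs.2.1 hr]
      rw [List.countP_eq_length (l := l.toList).2 fun p hp => by
        simpa using (hlr p hp k (Or.inl rfl)).trans_lt hv]
      omega
    · rename_i hv
      rw [ihl hs.1 hl, List.countP_eq_zero (l := r.toList).2 fun p hp => by
        simpa using (not_lt.1 hv).trans (hkr p hp)]
      simp

theorem val_countGreater (v : α) {t : RBTree α} (hs : t.SizesCorrect)
    (ht : t.toList.Pairwise (· ≤ ·)) :
    (countGreater v t).val = t.toList.countP (v < ·) := by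
  induction t with
  | nil => rfl
  | node c l k r s ihl ihr =>
    simp only [toList, List.pairwise_append, List.pairwise_cons, List.mem_cons] at ht
    obtain ⟨hl, ⟨hkr, hr⟩, hlr⟩ := ht
    simp only [countGreater, val_bind, val_less, decide_eq_true_eq, toList, List.countP_append,
      List.countP_cons]
    split
    · rename_i hv
      simp only [val_bind, val_add, hs.2.1.val_size, ihl hs.1 hl]
      rw [List.countP_eq_length (l := r.toList).2 fun p hp => by
        simpa using hv.trans_le (hkr p hp)]
      omega
    · rename_i hv
      rw [ihr hs.2.1 hr, List.countP_eq_zero (l := l.toList).2 fun p hp => by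
        simpa using (hlr p hp k (Or.inl rfl)).trans (not_lt.1 hv)]
      simp

theorem Valid.val_countLess {t : RBTree α} (ht : t.Valid) (v : α) :
    (countLess v t).val = t.toList.countP (· < v) := RBTree.val_countLess v ht.sizes ht.sorted

theorem Valid.val_countGreater {t : RBTree α} (ht : t.Valid) (v : α) :
    (countGreater v t).val = t.toList.countP (v < ·) :=
  RBTree.val_countGreater v ht.sizes ht.sorted

theorem length_eq_countP_add (v : α) (l : List α) :
    l.length = l.countP (· < v) + l.countP (v < ·) + l.countP (· = v) := by
  induction l with
  | nil => rfl
  | cons b l ih =>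
    simp only [List.length_cons, List.countP_cons, ih]
    rcases lt_trichotomy b v with h | h | h
    · simp [h, h.ne, h.not_gt]; omega
    · simp [h]; omega
    · simp [h, h.ne', h.not_gt]; omega

/-- Inclusion–exclusion: because `u < v`, every element satisfies at least one of the two
conditions. It makes the truncated subtraction in `countBetween` exact. -/
theorem countP_lt_add_countP_gt {u v : α} (huv : u < v) (l : List α) :
    l.countP (· < v) + l.countP (u < ·) = l.countP (fun b => u < b ∧ b < v) + l.length := by
  induction l with
  | nil => rfl
  | cons b l ih =>
    simp only [List.length_cons, List.countP_cons]
    have : u < b ∨ b < v := (lt_or_ge u b).imp_right fun h => h.trans_lt huv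
    by_cases h : u < b <;> by_cases h' : b < v <;> simp [h, h'] at this ih ⊢ <;> omega

theorem Valid.val_countEqual {t : RBTree α} (ht : t.Valid) (v : α) :
    (countEqual v t).val = t.toList.countP (· = v) := by
  simp only [countEqual, val_bind, val_sub, ht.sizes.val_size, ht.val_countLess,
    ht.val_countGreater, length_eq_countP_add v t.toList]
  omega

theorem Valid.val_countBetween {t : RBTree α} (ht : t.Valid) {u v : α} (huv : u < v) :
    (countBetween u v t).val = t.toList.countP (fun b => u < b ∧ b < v) := by
  simp only [countBetween, val_bind, val_sub, val_add, ht.sizes.val_size, ht.val_countLess,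
    ht.val_countGreater, countP_lt_add_countP_gt huv]
  omega

/-! ### Depth and cost -/

theorem Valid.depth_le {t : RBTree α} (ht : t.Valid) :
    t.depth ≤ 2 * Nat.log 2 (t.toList.length + 1) + 1 := by
  obtain ⟨c, h, hb⟩ := ht.balanced
  have := Nat.le_log_of_pow_le (by norm_num) hb.two_pow_le
  have := hb.depth_le.1
  omega

/-- At most 5 steps per level: call, comparison, reading a size, two additions; the final 1 is the
call at a leaf. -/
theorem cost_countLess_le (v : α) (t : RBTree α) : (countLess v t).cost ≤ 5 * t.depth + 1 := by
  induction t with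
  | nil => simp [countLess]
  | node c l k r s ihl ihr =>
    simp only [countLess, cost_bind, val_less, decide_eq_true_eq, depth]
    split <;> simp <;> omega

theorem cost_countGreater_le (v : α) (t : RBTree α) :
    (countGreater v t).cost ≤ 5 * t.depth + 1 := by
  induction t with
  | nil => simp [countGreater]
  | node c l k r s ihl ihr =>
    simp only [countGreater, cost_bind, val_less, decide_eq_true_eq, depth]
    split <;> simp <;> omega

theorem cost_countEqual_le (v : α) (t : RBTree α) :
    (countEqual v t).cost ≤ 10 * t.depth + 6 := by
  have := cost_countLess_le v t
  have := cost_countGreater_le v t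
  simp only [countEqual, cost_bind, cost_call, cost_size, cost_sub]
  omega

theorem cost_countBetween_le (u v : α) (t : RBTree α) :
    (countBetween u v t).cost ≤ 10 * t.depth + 6 := by
  have := cost_countLess_le v t
  have := cost_countGreater_le u t
  simp only [countBetween, cost_bind, cost_call, cost_size, cost_sub, cost_add]
  omega

theorem cost_insert_le (v : α) (t : RBTree α) : (insert v t).cost ≤ 18 * t.depth + 8 := by
  -- Per level a call, a comparison and at most 16 for `balance`; at the leaf a call and a node.
  have key : (insertAux v t).cost ≤ 18 * t.depth + 6 := by
    induction t with
    | nil => simp [insertAux]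
    | node c l k r s ihl ihr =>
      have h₁ := cost_balance_le c (insertAux v l).val k r
      have h₂ := cost_balance_le c l k (insertAux v r).val
      simp only [insertAux, cost_bind, val_less, decide_eq_true_eq, depth]
      split <;> simp <;> omega
  have : ∀ t' : RBTree α, (blackenRoot t').cost = 1 := by rintro (_ | _) <;> rfl
  simp only [insert, cost_bind, cost_call, this]
  omega

end

end RBTree

variable {α : Type}

/-! ### Sorting -/

@[simp] theorem val_length (l : List α) : (length l).val = l.length := by
  induction l with
  | nil => rfl
  | cons b l ih => simp [length, ih]

theorem cost_length (l : List α) : (length l).cost = 2 * l.length + 1 := by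
  induction l with
  | nil => rfl
  | cons b l ih => simp [length, ih]; omega

@[simp] theorem val_reverseOnto (l acc : List α) :
    (reverseOnto l acc).val = l.reverse ++ acc := by
  induction l generalizing acc with
  | nil => rfl
  | cons b l ih => simp [reverseOnto, ih]

theorem cost_reverseOnto (l acc : List α) : (reverseOnto l acc).cost = 2 * l.length + 1 := by
  induction l generalizing acc with
  | nil => rfl
  | cons b l ih => simp [reverseOnto, ih]; omega

section
variable [LinearOrder α]

theorem val_merge_perm (l r : List (α × α)) : (merge l r).val.Perm (l ++ r) := by
  fun_induction merge l r with
  | case1 r => simp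
  | case2 l => simp
  | case3 p l q r ih₁ ih₂ =>
    simp only [val_bind, val_less, decide_eq_true_eq]
    split
    · exact (ih₁.cons q).trans List.perm_middle.symm
    · exact ih₂.cons p

theorem pairwise_merge (l r : List (α × α)) (hl : l.Pairwise fun p q => p.1 ≤ q.1)
    (hr : r.Pairwise fun p q => p.1 ≤ q.1) :
    (merge l r).val.Pairwise fun p q => p.1 ≤ q.1 := by
  fun_induction merge l r with
  | case1 r => simpa using hr
  | case2 l => simpa using hl
  | case3 p l q r ih₁ ih₂ =>
    have hl' := List.pairwise_cons.1 hl
    have hr' := List.pairwise_cons.1 hr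
    simp only [val_bind, val_less, decide_eq_true_eq]
    split
    · rename_i h
      refine List.pairwise_cons.2 ⟨fun u hu => ?_, ih₁ hl hr'.2⟩
      have := (val_merge_perm _ _).mem_iff.1 hu
      rw [List.mem_append, List.mem_cons] at this
      obtain (rfl | hu) | hu := this
      · exact h.le
      · exact h.le.trans (hl'.1 u hu)
      · exact hr'.1 u hu
    · rename_i h
      refine List.pairwise_cons.2 ⟨fun u hu => ?_, ih₂ hl'.2 hr⟩
      have := (val_merge_perm _ _).mem_iff.1 hu
      rw [List.mem_append, List.mem_cons] at this
      obtain hu | rfl | hu := this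
      · exact hl'.1 u hu
      · exact not_lt.1 h
      · exact (not_lt.1 h).trans (hr'.1 u hu)

theorem cost_merge_le (l r : List (α × α)) :
    (merge l r).cost ≤ 3 * (l.length + r.length) + 1 := by
  fun_induction merge l r with
  | case1 r => simp
  | case2 l => simp
  | case3 p l q r ih₁ ih₂ =>
    simp only [List.length_cons] at ih₁ ih₂ ⊢
    simp only [cost_bind, val_less, decide_eq_true_eq]
    split <;> simp <;> omega

/-- The three claims are proved together because the second recursive call runs on the remainder
left by the first. -/
theorem val_mergeSort (m : ℕ) (l : List (α × α)) :
    (mergeSort m l).val.1.Perm (l.take m) ∧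
      ((mergeSort m l).val.1.Pairwise fun p q => p.1 ≤ q.1) ∧
      (mergeSort m l).val.2 = l.drop m := by
  fun_induction mergeSort m l with
  | case1 l => simp
  | case2 => simp
  | case3 p l => simp
  | case4 m l ih₁ ih₂ =>
    simp only [val_bind, val_pure]
    obtain ⟨p₁, s₁, e₁⟩ := ih₁
    obtain ⟨p₂, s₂, e₂⟩ := ih₂ (mergeSort ((m + 2) / 2) l).val
    have hm : m + 2 = (m + 2) / 2 + (m + 2 - (m + 2) / 2) := by omega
    refine ⟨?_, pairwise_merge _ _ s₁ s₂, ?_⟩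
    · refine (val_merge_perm _ _).trans ((p₁.append p₂).trans ?_)
      rw [e₁, ← List.take_add, ← hm]
    · rw [e₂, e₁, List.drop_drop, ← hm]

/-- A quadratic bound is enough here and avoids logarithms in the recursion. -/
theorem cost_mergeSort_le (m : ℕ) (l : List (α × α)) :
    (mergeSort m l).cost ≤ 8 * m ^ 2 + 1 := by
  fun_induction mergeSort m l with
  | case1 l => simp
  | case2 => simp
  | case3 p l => simp
  | case4 m l ih₁ ih₂ =>
    have h₁ := (val_mergeSort ((m + 2) / 2) l).1.length_eq
    have h₂ := (val_mergeSort (m + 2 - (m + 2) / 2)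
      (mergeSort ((m + 2) / 2) l).val.2).1.length_eq
    have h₃ := cost_merge_le (mergeSort ((m + 2) / 2) l).val.1 (mergeSort (m + 2 - (m + 2) / 2)
      (mergeSort ((m + 2) / 2) l).val.2).val.1
    have h₄ := ih₂ (mergeSort ((m + 2) / 2) l).val
    rw [List.length_take] at h₁ h₂
    simp only [cost_bind, cost_call, cost_div, cost_sub, cost_pure]
    change _ ≤ 8 * (m + 2) ^ 2 + 1
    have hu : 1 ≤ (m + 2) / 2 := by omega
    have hv : 1 ≤ m + 2 - (m + 2) / 2 := by omega
    have hm : m + 2 = (m + 2) / 2 + (m + 2 - (m + 2) / 2) := by omega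
    conv_rhs => rw [hm]
    generalize m + 2 - (m + 2) / 2 = v at *
    generalize (m + 2) / 2 = u at *
    have := Nat.mul_le_mul hu hv
    -- This is `(u - 1) * (v - 1) ≥ 0`. It lets the cross term `16 * u * v` of `8 * (u + v) ^ 2`
    -- absorb the linear cost of merging.
    have : u + v ≤ u * v + 1 := by nlinarith
    have := min_le_left u l.length
    have := min_le_left v (mergeSort u l).val.2.length
    nlinarith

theorem sortPoints_perm (l : List (α × α)) : (sortPoints l).val.Perm l := by
  simpa [sortPoints] using (val_mergeSort l.length l).1

theorem pairwise_sortPoints (l : List (α × α)) :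
    (sortPoints l).val.Pairwise fun p q => p.1 ≤ q.1 := by
  simpa [sortPoints] using (val_mergeSort l.length l).2.1

theorem cost_sortPoints_le (l : List (α × α)) :
    (sortPoints l).cost ≤ 8 * l.length ^ 2 + 2 * l.length + 3 := by
  have := cost_mergeSort_le l.length l
  simp only [sortPoints, cost_bind, cost_call, cost_length, val_length, cost_pure]
  omega

end

/-! ### Delayed insertion -/

section
variable [LinearOrder α]

theorem val_insertAll {t : RBTree α} (ht : t.Valid) (l : List α) :
    (insertAll l t).val.Valid ∧ (insertAll l t).val.toList.Perm (l ++ t.toList) := by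
  induction l generalizing t with
  | nil => exact ⟨ht, .refl _⟩
  | cons v l ih =>
    simp only [insertAll, val_bind]
    obtain ⟨h₁, h₂⟩ := ih (ht.insert v)
    exact ⟨h₁, h₂.trans (((RBTree.toList_insert_perm v t).append_left l).trans List.perm_middle)⟩

/-- A bound for the depth of a tree with at most `N` keys. -/
def depthBound (N : ℕ) : ℕ := 2 * Nat.log 2 (N + 1) + 1

theorem RBTree.Valid.depth_le_depthBound {t : RBTree α} (ht : t.Valid) {N : ℕ}
    (hN : t.toList.length ≤ N) : t.depth ≤ depthBound N := by
  have := ht.depth_le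
  have := Nat.log_mono_right (b := 2) (Nat.add_le_add_right hN 1)
  unfold depthBound
  omega

theorem cost_insertAll_le {t : RBTree α} (ht : t.Valid) (l : List α) {N : ℕ}
    (hN : t.toList.length + l.length ≤ N) :
    (insertAll l t).cost ≤ l.length * (18 * depthBound N + 9) + 1 := by
  induction l generalizing t with
  | nil => simp [insertAll]
  | cons v l ih =>
    have h₁ := RBTree.cost_insert_le v t
    have h₂ := ht.depth_le_depthBound (N := N) (by omega)
    have h₃ := (RBTree.toList_insert_perm v t).length_eq
    rw [List.length_cons] at hN h₃
    have h₄ := ih (ht.insert v) (by omega)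
    simp only [insertAll, cost_bind, cost_call, List.length_cons, add_one_mul]
    omega

/-- Every release is charged as if it inserted `N` values. No amortisation is needed, since an inner
loop is allowed the same order of cost. -/
theorem cost_release_le {t : RBTree α} (ht : t.Valid) (prev : Option α) (x : α)
    (saved : List α) {N : ℕ} (hN : t.toList.length + saved.length ≤ N) :
    (release prev x t saved).cost ≤ N * (18 * depthBound N + 9) + 3 := by
  have h₁ := cost_insertAll_le ht saved hN
  have h₂ : saved.length * (18 * depthBound N + 9) ≤ N * (18 * depthBound N + 9) :=
    Nat.mul_le_mul_right _ (by omega)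
  unfold release
  split
  · simp
  · simp only [cost_bind, val_equal, decide_eq_true_eq]
    split <;> simp; omega

/-- Values only move from the list to the tree; the preserved total keeps one size bound `N` valid
throughout a pass. -/
theorem release_valid {t : RBTree α} (ht : t.Valid) (prev : Option α) (x : α)
    (saved : List α) :
    (release prev x t saved).val.1.Valid ∧
      (release prev x t saved).val.1.toList.length + (release prev x t saved).val.2.length =
        t.toList.length + saved.length := by
  have := val_insertAll ht saved
  unfold release
  split
  · simp [ht]
  · simp only [val_bind, val_equal, decide_eq_true_eq]
    split
    · simp [ht]
    · simp [this.1, this.2.length_eq, add_comm]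

/-- The tree `t` holds the second coordinates of the points in `pre` whose first coordinate is not
`x`, and `saved` holds those of the remaining points. -/
structure Holds (x : α) (t : RBTree α) (saved : List α) (pre : Multiset (α × α)) : Prop where
  valid : t.Valid
  keys : (t.toList : Multiset α) = (pre.filter fun p => p.1 ≠ x).map Prod.snd
  saved : (saved : Multiset α) = (pre.filter fun p => p.1 = x).map Prod.snd

/-- The state of the tree and of the saved values after the points in `pre`, the last of which has
first coordinate `prev`. -/
def State (prev : Option α) (t : RBTree α) (saved : List α) (pre : Multiset (α × α)) : Prop :=
  match prev with
  | none => pre = 0 ∧ t = .nil ∧ saved = []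
  | some x => Holds x t saved pre

/-- If the first coordinate has changed, `hx` says that no earlier point has the new one, so all
saved values belong in the tree. If it has not, the state is already the right one. -/
theorem State.holds_release {prev : Option α} {t : RBTree α} {saved : List α}
    {pre : Multiset (α × α)} (h : State prev t saved pre) {x : α}
    (hx : ∀ x' ∈ prev, x' ≠ x → ∀ p ∈ pre, p.1 ≠ x) :
    Holds x (release prev x t saved).val.1 (release prev x t saved).val.2 pre := by
  unfold release
  split
  · obtain ⟨rfl, rfl, rfl⟩ := h
    exact ⟨RBTree.valid_nil, by simp [RBTree.toList], by simp⟩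
  · rename_i x'
    have h : Holds x' t saved pre := h
    simp only [val_bind, val_equal, decide_eq_true_eq]
    split
    · rename_i e
      subst e
      exact h
    · rename_i e
      have hx := hx x' rfl e
      obtain ⟨h₁, h₂⟩ := val_insertAll h.valid saved
      refine ⟨h₁, ?_, ?_⟩
      · simp only [val_bind, val_pure, Multiset.coe_eq_coe.2 h₂, ← Multiset.coe_add, h.saved,
          h.keys, ← Multiset.map_add, Multiset.filter_add_not]
        rw [Multiset.filter_eq_self.2 hx]
      · rw [Multiset.filter_eq_nil.2 hx]
        rfl

theorem Holds.cons {x : α} {t : RBTree α} {saved : List α} {pre : Multiset (α × α)}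
    (h : Holds x t saved pre) (y : α) : State (some x) t (y :: saved) ((x, y) ::ₘ pre) :=
  ⟨h.valid, by simp [h.keys], by simp [← h.saved]⟩

/-! ### The values of the two passes -/

/-- Sum of `f pre p q` over all pairs of an entry `p` and a later entry `q` of a list, where `pre`
consists of the given initial points and the entries before `p`. -/
def sumPairs {β M : Type} [AddCommMonoid M] (f : Multiset β → β → β → M) :
    List β → Multiset β → M
  | [], _ => 0
  | p :: l, pre => (l.map (f pre p)).sum + sumPairs f l (p ::ₘ pre)

theorem sumPairs_cons {β M : Type} [AddCommMonoid M] (f : Multiset β → β → β → M) (p : β)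
    (l : List β) (pre : Multiset β) :
    sumPairs f (p :: l) pre = (l.map (f pre p)).sum + sumPairs f l (p ::ₘ pre) := rfl

/-- The number of pairs of keys that are concordant with the second coordinates `y`, `z`. -/
def concordantCount (K : Multiset α) (y z : α) : ℕ :=
  (K.countP (max y z < ·)).choose 2 + (K.countP (· < min y z)).choose 2

/-- The number of pairs of keys that are discordant or over-counted with the second coordinates
`y`, `z`. -/
def discordantCount (K : Multiset α) (y z : α) : ℕ :=
  if y = z then 0 else
    let top := K.countP (max y z < ·)
    let mid := K.countP fun b => min y z < b ∧ b < max y z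
    let bot := K.countP (· < min y z)
    let eqMin := K.countP (· = min y z)
    let eqMax := K.countP (· = max y z)
    mid.choose 2 + top * mid + top * bot + mid * bot + eqMin * (top + mid + eqMax) +
      eqMax * (mid + bot)

/-- The number of pairs of keys that are over-counted with the second coordinates `y`, `z`. -/
def overcountedCount (K : Multiset α) (y z : α) : ℕ :=
  if y = z then K.countP (y < ·) * K.countP (· < y) else 0

/-- The second coordinates of the points whose first coordinate is not `x`. -/
def keysApart (x : α) (pre : Multiset (α × α)) : Multiset α :=
  (pre.filter fun p => p.1 ≠ x).map Prod.snd

@[simp] theorem val_chooseTwo (m : ℕ) : (chooseTwo m).val = m.choose 2 := by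
  simp [chooseTwo, Nat.choose_two_right]

@[simp] theorem cost_chooseTwo (m : ℕ) : (chooseTwo m).cost = 4 := rfl

theorem val_firstInner {t : RBTree α} (ht : t.Valid) (y : α) (l : List (α × α)) (con dis : ℤ) :
    (firstInner t y l con dis).val =
      (con + ((l.map fun p => concordantCount t.toList y p.2).sum : ℕ),
        dis + ((l.map fun p => discordantCount t.toList y p.2).sum : ℕ)) := by
  induction l generalizing con dis with
  | nil => simp [firstInner]
  | cons p l ih =>
    simp only [firstInner, val_bind, val_equal, val_minimum, val_maximum, decide_eq_true_eq,
      ht.val_countGreater, ht.val_countLess, ht.val_countEqual, val_chooseTwo, val_add,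
      val_natToInt]
    -- `countBetween` is evaluated only for distinct values; for equal ones its result is not used.
    by_cases h : y = p.2
    · rw [if_pos (by simp [h]), ih, List.map_cons, List.sum_cons, List.map_cons, List.sum_cons]
      generalize (List.map _ l : List ℕ).sum = S
      generalize (List.map _ l : List ℕ).sum = S'
      simp [h, concordantCount, discordantCount]
      ring
    · rw [ht.val_countBetween (min_lt_max.2 h), if_neg (min_lt_max.2 h).ne]
      simp only [val_bind]
      rw [ih, List.map_cons, List.sum_cons, List.map_cons, List.sum_cons]
      generalize (List.map _ l : List ℕ).sum = S
      generalize (List.map _ l : List ℕ).sum = S'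
      simp only [concordantCount, discordantCount, discordantTerm, h, if_false, val_bind, val_add,
        val_mul, val_chooseTwo, val_natToInt, Multiset.coe_countP, Prod.mk.injEq]
      constructor <;> push_cast <;> ring

theorem val_secondInner {t : RBTree α} (ht : t.Valid) (y : α) (l : List (α × α)) (dis : ℤ) :
    (secondInner t y l dis).val =
      dis - ((l.map fun p => overcountedCount t.toList y p.2).sum : ℕ) := by
  induction l generalizing dis with
  | nil => simp [secondInner]
  | cons p l ih =>
    simp only [secondInner, val_bind, val_equal, val_minimum, val_maximum, decide_eq_true_eq,
      ht.val_countGreater, ht.val_countLess]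
    by_cases h : y = p.2
    · rw [if_pos (by simp [h])]
      simp only [val_bind]
      rw [ih, List.map_cons, List.sum_cons]
      generalize (List.map _ l : List ℕ).sum = S
      simp [h, overcountedCount]
      ring
    · rw [if_neg (min_lt_max.2 (Ne.symm h)).ne]
      simp [h, ih, overcountedCount]

/-- The points in `pre` precede `l`, and `prev` is the first coordinate of the last of them. -/
def Precedes (R : α → α → Prop) (prev : Option α) (pre : Multiset (α × α)) (l : List (α × α)) :
    Prop :=
  (l.Pairwise fun p q => R p.1 q.1) ∧
    ∀ x ∈ prev, (∀ p ∈ pre, R p.1 x) ∧ ∀ p ∈ l, R x p.1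

section
variable {R : α → α → Prop} [IsPartialOrder α R]

/-- An abstract order serves both passes, `≤` for the first and `≥` for the second. By antisymmetry,
an earlier point tied with `p` forces the previous first coordinate to be tied as well. -/
theorem Precedes.holds_release {prev : Option α} {t : RBTree α} {saved : List α}
    {pre : Multiset (α × α)} {p : α × α} {l : List (α × α)} (h : Precedes R prev pre (p :: l))
    (hs : State prev t saved pre) :
    Holds p.1 (release prev p.1 t saved).val.1 (release prev p.1 t saved).val.2 pre := by
  refine hs.holds_release fun x hx hxp u hu e => hxp ?_
  obtain ⟨h₁, h₂⟩ := h.2 x hx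
  exact antisymm_of R (h₂ p List.mem_cons_self) (e ▸ h₁ u hu)

theorem Precedes.cons {prev : Option α} {t : RBTree α} {saved : List α}
    {pre : Multiset (α × α)} {p : α × α} {l : List (α × α)} (h : Precedes R prev pre (p :: l))
    (hs : State prev t saved pre) : Precedes R (some p.1) (p ::ₘ pre) l := by
  obtain ⟨h₁, h₂⟩ := List.pairwise_cons.1 h.1
  refine ⟨h₂, fun x hx => ?_⟩
  obtain rfl : p.1 = x := Option.some.inj hx
  refine ⟨fun u hu => ?_, h₁⟩
  obtain rfl | hu := Multiset.mem_cons.1 hu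
  · exact refl_of R _
  · cases prev with
    | none =>
      obtain ⟨rfl, -⟩ := hs
      simp at hu
    | some x =>
      exact trans_of R ((h.2 x rfl).1 u hu) ((h.2 x rfl).2 p List.mem_cons_self)

theorem val_firstOuter (l : List (α × α)) (prev : Option α) (t : RBTree α) (saved : List α)
    (pre : Multiset (α × α)) (h : Precedes R prev pre l) (hs : State prev t saved pre)
    (con dis : ℤ) :
    (firstOuter l prev t saved con dis).val =
      (con + (sumPairs (fun pre p q => concordantCount (keysApart p.1 pre) p.2 q.2) l pre : ℕ),
        dis + (sumPairs (fun pre p q => discordantCount (keysApart p.1 pre) p.2 q.2) l pre : ℕ)) := by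
  fun_induction firstOuter l prev t saved con dis generalizing pre with
  | case1 => simp [sumPairs]
  -- Stopping before the last point loses nothing: no pair starts there.
  | case2 => simp [sumPairs]
  | case3 p q l prev t saved con dis ih =>
    have h₁ := h.holds_release hs
    simp only [val_bind, val_cons]
    rw [ih _ _ _ (p ::ₘ pre) (h.cons hs) (h₁.cons p.2), val_firstInner h₁.valid,
      sumPairs_cons _ p, sumPairs_cons _ p, h₁.keys]
    simp only [keysApart, Nat.cast_add, add_assoc]

theorem val_secondOuter (l : List (α × α)) (prev : Option α) (t : RBTree α) (saved : List α)
    (pre : Multiset (α × α)) (h : Precedes R prev pre l) (hs : State prev t saved pre)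
    (dis : ℤ) :
    (secondOuter l prev t saved dis).val =
      dis - (sumPairs (fun pre p q => overcountedCount (keysApart p.1 pre) p.2 q.2) l pre : ℕ) := by
  fun_induction secondOuter l prev t saved dis generalizing pre with
  | case1 => simp [sumPairs]
  | case2 => simp [sumPairs]
  | case3 p q l prev t saved dis ih =>
    have h₁ := h.holds_release hs
    simp only [val_bind, val_cons, val_secondInner h₁.valid]
    rw [ih _ _ _ (p ::ₘ pre) (h.cons hs) (h₁.cons p.2), sumPairs_cons _ p, h₁.keys]
    simp only [keysApart, Nat.cast_add]
    ring

end

theorem val_firstPass (l : List (α × α)) (hl : l.Pairwise fun p q => p.1 ≤ q.1) :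
    (firstPass l).val =
      (((sumPairs (fun pre p q => concordantCount (keysApart p.1 pre) p.2 q.2) l 0 : ℕ) : ℤ),
        ((sumPairs (fun pre p q => discordantCount (keysApart p.1 pre) p.2 q.2) l 0 : ℕ) : ℤ)) := by
  have := val_firstOuter (R := (· ≤ ·)) l none .nil [] 0 ⟨hl, by simp⟩ ⟨rfl, rfl, rfl⟩ 0 0
  simpa [firstPass] using this

theorem val_secondPass (l : List (α × α)) (hl : l.Pairwise fun p q => p.1 ≤ q.1) (dis : ℤ) :
    (secondPass l dis).val = dis -
      (sumPairs (fun pre p q => overcountedCount (keysApart p.1 pre) p.2 q.2) l.reverse 0 : ℕ) := by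
  have := val_secondOuter (R := (· ≥ ·)) l.reverse none .nil [] 0
    ⟨List.pairwise_reverse.2 hl, by simp⟩ ⟨rfl, rfl, rfl⟩ dis
  simpa [secondPass] using this

/-! ### The cost of the two passes -/

/-- The queries account for `40 * D`: two one-sided counts at `5 * D` and three composite ones at
`10 * D`. The 60 covers everything else. -/
theorem cost_firstInner_le {t : RBTree α} (y : α) (l : List (α × α)) (con dis : ℤ) {D : ℕ}
    (hD : t.depth ≤ D) :
    (firstInner t y l con dis).cost ≤ l.length * (40 * D + 60) + 1 := by
  induction l generalizing con dis with
  | nil => simp [firstInner]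
  | cons p l ih =>
    have h₁ := RBTree.cost_countGreater_le (max y p.2) t
    have h₂ := RBTree.cost_countBetween_le (min y p.2) (max y p.2) t
    have h₃ := RBTree.cost_countLess_le (min y p.2) t
    have h₄ := RBTree.cost_countEqual_le (min y p.2) t
    have h₅ := RBTree.cost_countEqual_le (max y p.2) t
    simp only [firstInner, cost_bind, val_equal, val_minimum, val_maximum, decide_eq_true_eq,
      cost_minimum, cost_maximum, cost_call, cost_chooseTwo, cost_add, cost_natToInt, cost_equal,
      List.length_cons, add_one_mul]
    generalize RBTree.countGreater (max y p.2) t = c₁ at *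
    generalize RBTree.countBetween (min y p.2) (max y p.2) t = c₂ at *
    generalize RBTree.countLess (min y p.2) t = c₃ at *
    generalize RBTree.countEqual (min y p.2) t = c₄ at *
    generalize RBTree.countEqual (max y p.2) t = c₅ at *
    split
    · generalize hr : firstInner t y l _ _ = r
      have : r.cost ≤ l.length * (40 * D + 60) + 1 := hr ▸ ih _ _
      omega
    · simp only [cost_bind, discordantTerm, cost_chooseTwo, cost_mul, cost_add, cost_natToInt,
        cost_call]
      generalize hr : firstInner t y l _ _ = r
      have : r.cost ≤ l.length * (40 * D + 60) + 1 := hr ▸ ih _ _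
      clear hr
      linarith

theorem cost_secondInner_le {t : RBTree α} (y : α) (l : List (α × α)) (dis : ℤ) {D : ℕ}
    (hD : t.depth ≤ D) :
    (secondInner t y l dis).cost ≤ l.length * (40 * D + 60) + 1 := by
  induction l generalizing dis with
  | nil => simp [secondInner]
  | cons p l ih =>
    have h₁ := RBTree.cost_countGreater_le (max p.2 y) t
    have h₃ := RBTree.cost_countLess_le (min p.2 y) t
    simp only [secondInner, cost_bind, val_equal, val_minimum, val_maximum, decide_eq_true_eq,
      cost_minimum, cost_maximum, cost_call, cost_equal, List.length_cons, add_one_mul]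
    split
    · have := ih (dis - ((RBTree.countGreater (max p.2 y) t).val *
        (RBTree.countLess (min p.2 y) t).val : ℕ))
      simp only [cost_bind, cost_mul, cost_natToInt, cost_sub, val_sub, val_natToInt, val_mul]
      omega
    · have := ih dis
      omega

theorem cost_firstOuter_le (l : List (α × α)) (prev : Option α) {t : RBTree α} (ht : t.Valid)
    (saved : List α) (con dis : ℤ) {N : ℕ} (hN : t.toList.length + saved.length + l.length ≤ N) :
    (firstOuter l prev t saved con dis).cost ≤
      -- Here 58 = 18 + 40 and 69 = 9 + 60 add the costs of a release and of an inner loop; 6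
      -- collects their constants, the call and the list cell.
      l.length * (N * (58 * depthBound N + 69) + 6) + 1 := by
  fun_induction firstOuter l prev t saved con dis with
  | case1 => simp
  | case2 => simp
  | case3 p q l prev t saved con dis ih =>
    rw [List.length_cons] at hN
    obtain ⟨h₁, h₂⟩ := release_valid ht prev p.1 saved
    have h₃ := cost_release_le ht prev p.1 saved (N := N) (by omega)
    have h₄ := cost_firstInner_le p.2 (q :: l) con dis
      (h₁.depth_le_depthBound (N := N) (by omega))
    have h₅ := ih (release prev p.1 t saved).val (p.2 :: (release prev p.1 t saved).val.2)
      (firstInner (release prev p.1 t saved).val.1 p.2 (q :: l) con dis).val h₁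
      (by simp only [List.length_cons] at h₂ hN ⊢; omega)
    have h₆ : (q :: l).length * (40 * depthBound N + 60) ≤ N * (40 * depthBound N + 60) :=
      Nat.mul_le_mul_right _ (by omega)
    have h₇ : N * (58 * depthBound N + 69) =
      N * (18 * depthBound N + 9) + N * (40 * depthBound N + 60) := by ring
    rw [List.length_cons, add_one_mul]
    simp only [cost_bind, cost_call, cost_cons, val_cons]
    omega

theorem cost_secondOuter_le (l : List (α × α)) (prev : Option α) {t : RBTree α} (ht : t.Valid)
    (saved : List α) (dis : ℤ) {N : ℕ} (hN : t.toList.length + saved.length + l.length ≤ N) :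
    (secondOuter l prev t saved dis).cost ≤
      l.length * (N * (58 * depthBound N + 69) + 6) + 1 := by
  fun_induction secondOuter l prev t saved dis with
  | case1 => simp
  | case2 => simp
  | case3 p q l prev t saved dis ih =>
    rw [List.length_cons] at hN
    obtain ⟨h₁, h₂⟩ := release_valid ht prev p.1 saved
    have h₃ := cost_release_le ht prev p.1 saved (N := N) (by omega)
    have h₄ := cost_secondInner_le p.2 (q :: l) dis
      (h₁.depth_le_depthBound (N := N) (by omega))
    have h₅ := ih (release prev p.1 t saved).val (p.2 :: (release prev p.1 t saved).val.2)
      (secondInner (release prev p.1 t saved).val.1 p.2 (q :: l) dis).val h₁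
      (by simp only [List.length_cons] at h₂ hN ⊢; omega)
    have h₆ : (q :: l).length * (40 * depthBound N + 60) ≤ N * (40 * depthBound N + 60) :=
      Nat.mul_le_mul_right _ (by omega)
    have h₇ : N * (58 * depthBound N + 69) =
      N * (18 * depthBound N + 9) + N * (40 * depthBound N + 60) := by ring
    rw [List.length_cons, add_one_mul]
    simp only [cost_bind, cost_call, cost_cons, val_cons]
    omega

theorem cost_firstPass_le (l : List (α × α)) :
    (firstPass l).cost ≤
      l.length * (l.length * (58 * depthBound l.length + 69) + 6) + 2 := by
  have := cost_firstOuter_le l none RBTree.valid_nil [] 0 0 (N := l.length)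
    (by simp [RBTree.toList])
  simp only [firstPass, cost_bind, cost_call]
  omega

theorem cost_secondPass_le (l : List (α × α)) (dis : ℤ) :
    (secondPass l dis).cost ≤
      l.length * (l.length * (58 * depthBound l.length + 69) + 6) + 2 * l.length + 3 := by
  have := cost_secondOuter_le l.reverse none RBTree.valid_nil [] dis (N := l.length)
    (by simp [RBTree.toList])
  rw [List.length_reverse] at this
  simp only [secondPass, cost_bind, cost_call, cost_reverseOnto, val_reverseOnto, List.append_nil]
  omega

end

/-! ### The cost of the algorithm -/

theorem cost_algorithm_le (l : List (ℝ × ℝ)) :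
    -- 116 = 2 · 58, and 146 = 2 · 69 + 8 with the 8 coming from sorting.
    (algorithm l).cost ≤ l.length ^ 2 * (116 * depthBound l.length + 146) + 18 * l.length + 25 := by
  have h₁ := (sortPoints_perm l).length_eq
  have h₂ := cost_sortPoints_le l
  have h₃ := cost_firstPass_le (sortPoints l).val
  have h₄ := cost_secondPass_le (sortPoints l).val (firstPass (sortPoints l).val).val.2
  have h₅ : ∀ (n : ℕ) (c d : ℤ), (combine n c d).cost = 14 := fun _ _ _ => rfl
  rw [h₁] at h₃ h₄
  simp only [algorithm, cost_bind, cost_call, cost_length, h₅]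
  nlinarith

theorem depthBound_le {n : ℕ} (hn : 2 ≤ n) :
    (depthBound n : ℝ) ≤ 12 * Real.log n := by
  have h₁ : (Nat.log 2 (n + 1) : ℝ) ≤ Real.logb 2 ((n + 1 : ℕ) : ℝ) :=
    Real.natLog_le_logb (n + 1) 2
  -- For `n ≥ 2` one has `n + 1 ≤ n ^ 2`.
  have h₂ : Real.log ((n + 1 : ℕ) : ℝ) ≤ 2 * Real.log n := by
    rw [← Real.log_rpow (by positivity)]
    refine Real.log_le_log (by positivity) ?_
    norm_cast
    nlinarith
  have h₃ : Real.log 2 ≤ Real.log n := Real.log_le_log (by norm_num) (by exact_mod_cast hn)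
  have h₄ := Real.log_two_gt_d9
  rw [Real.logb, le_div_iff₀ (by linarith)] at h₁
  have h₅ : (0 : ℝ) ≤ Nat.log 2 (n + 1) := Nat.cast_nonneg _
  rw [depthBound]
  push_cast
  nlinarith

theorem cost_algorithm_points_le {n : ℕ} (hn : 2 ≤ n) (x y : Fin n → ℝ) :
    ((algorithm (points x y)).cost : ℝ) ≤ 3000 * ((n : ℝ) ^ 2 * Real.log n) := by
  have h₁ : ((algorithm (points x y)).cost : ℝ) ≤
      (n : ℝ) ^ 2 * (116 * depthBound n + 146) + 18 * n + 25 := by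
    have := cost_algorithm_le (points x y)
    rw [points, List.length_ofFn] at this
    exact_mod_cast this
  have h₂ := depthBound_le hn
  have h₃ : Real.log 2 ≤ Real.log n := Real.log_le_log (by norm_num) (by exact_mod_cast hn)
  have h₄ := Real.log_two_gt_d9
  have hn' : (2 : ℝ) ≤ n := by exact_mod_cast hn
  -- For `n ≥ 2`, `18 * n ≤ 9 * n ^ 2` and `25 ≤ 7 * n ^ 2`.
  have h₅ : (n : ℝ) ^ 2 * (116 * depthBound n + 146) + 18 * n + 25 ≤
      (n : ℝ) ^ 2 * (116 * depthBound n + 146 + 9 + 7) := by nlinarith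
  have h₆ : 116 * (depthBound n : ℝ) + 146 + 9 + 7 ≤ 3000 * Real.log n := by linarith
  have := mul_le_mul_of_nonneg_left h₆ (sq_nonneg (n : ℝ))
  linarith

/-! ### Quadruples as multisets of points -/

/-- Four points which, relabelled by ascending first coordinate, satisfy `P`. -/
def Quad (P : (Fin 4 → ℝ) → (Fin 4 → ℝ) → Prop) (S : Multiset (ℝ × ℝ)) : Prop :=
  ∃ u v : Fin 4 → ℝ, S = {(u 0, v 0), (u 1, v 1), (u 2, v 2), (u 3, v 3)} ∧
    (u 0 ≤ u 1 ∧ u 1 ≤ u 2 ∧ u 2 ≤ u 3) ∧ P u v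

open Classical in
/-- The indicator function of `Quad P`. -/
noncomputable def quadIndicator (P : (Fin 4 → ℝ) → (Fin 4 → ℝ) → Prop)
    (S : Multiset (ℝ × ℝ)) : ℕ := if Quad P S then 1 else 0

theorem map_univ_val_fin_four {n : ℕ} (e : Fin 4 ↪ Fin n) :
    (Finset.univ.map e).val = {e 0, e 1, e 2, e 3} := by
  simp [Fin.univ_succ]

theorem exists_cons_of_map_eq_cons {β γ : Type} {f : β → γ} {s : Multiset β} {c : γ}
    {t : Multiset γ} (h : s.map f = c ::ₘ t) :
    ∃ b s', s = b ::ₘ s' ∧ f b = c ∧ s'.map f = t := by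
  classical
  obtain ⟨b, hb, e, h'⟩ := (Multiset.map_eq_cons f s t c).2 h
  exact ⟨b, _, (Multiset.cons_erase hb).symm, e, h'⟩

/-- The property depends only on the multiset of the four points. Conversely, indices are recovered
one point at a time; they are distinct because `S` has no repetitions, even if points coincide. -/
theorem exists_labels_iff (P : (Fin 4 → ℝ) → (Fin 4 → ℝ) → Prop) {n : ℕ} (x y : Fin n → ℝ)
    (S : Finset (Fin n)) :
    (∃ e : Fin 4 ↪ Fin n, Labels x S e ∧ P (x ∘ e) (y ∘ e)) ↔
      Quad P (S.val.map fun i => (x i, y i)) := by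
  constructor
  · rintro ⟨e, ⟨rfl, h⟩, hP⟩
    exact ⟨x ∘ e, y ∘ e, by rw [map_univ_val_fin_four]; simp, h, hP⟩
  · rintro ⟨u, v, hS, h, hP⟩
    obtain ⟨i, T, hT, ei, hS⟩ := exists_cons_of_map_eq_cons hS
    obtain ⟨j, U, rfl, ej, hS⟩ := exists_cons_of_map_eq_cons hS
    obtain ⟨k, V, rfl, ek, hS⟩ := exists_cons_of_map_eq_cons hS
    obtain ⟨l, W, rfl, el, hS⟩ := exists_cons_of_map_eq_cons hS
    obtain rfl := Multiset.map_eq_zero.1 hS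
    replace hS := hT
    have hd := S.nodup
    rw [hS] at hd
    have hinj : Function.Injective ![i, j, k, l] := by
      rw [← List.nodup_ofFn]
      simpa [List.ofFn_succ] using hd
    have hu : x ∘ ![i, j, k, l] = u := by
      ext m
      fin_cases m
      exacts [congrArg Prod.fst ei, congrArg Prod.fst ej, congrArg Prod.fst ek,
        congrArg Prod.fst el]
    have hv : y ∘ ![i, j, k, l] = v := by
      ext m
      fin_cases m
      exacts [congrArg Prod.snd ei, congrArg Prod.snd ej, congrArg Prod.snd ek,
        congrArg Prod.snd el]
    refine ⟨⟨![i, j, k, l], hinj⟩, ⟨?_, ?_⟩, ?_⟩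
    · refine Finset.val_injective ?_
      rw [map_univ_val_fin_four, hS]
      rfl
    · change (x ∘ ![i, j, k, l]) 0 ≤ (x ∘ ![i, j, k, l]) 1 ∧
        (x ∘ ![i, j, k, l]) 1 ≤ (x ∘ ![i, j, k, l]) 2 ∧
        (x ∘ ![i, j, k, l]) 2 ≤ (x ∘ ![i, j, k, l]) 3
      rwa [hu]
    · change P (x ∘ ![i, j, k, l]) (y ∘ ![i, j, k, l])
      rwa [hu, hv]

theorem sum_powersetCard_points {M : Type} [AddCommMonoid M] {n : ℕ} (x y : Fin n → ℝ)
    (g : Multiset (ℝ × ℝ) → M) (k : ℕ) :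
    ∑ S ∈ Finset.powersetCard k Finset.univ, g (S.val.map fun i => (x i, y i)) =
      ((Multiset.powersetCard k (points x y : Multiset (ℝ × ℝ))).map g).sum := by
  have : (points x y : Multiset (ℝ × ℝ)) =
      (Finset.univ : Finset (Fin n)).val.map fun i => (x i, y i) := by
    rw [points, List.ofFn_eq_map, ← Multiset.map_coe]
    rfl
  rw [this, Multiset.powersetCard_map, ← Finset.map_val_val_powersetCard, Multiset.map_map,
    Multiset.map_map]
  rfl

theorem numQuadruples_eq_sum (P : (Fin 4 → ℝ) → (Fin 4 → ℝ) → Prop) {n : ℕ} (x y : Fin n → ℝ) :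
    numQuadruples P x y =
      ((Multiset.powersetCard 4 (points x y : Multiset (ℝ × ℝ))).map (quadIndicator P)).sum := by
  classical
  rw [← sum_powersetCard_points, numQuadruples, Finset.card_filter]
  exact Finset.sum_congr rfl fun S _ => if_congr (exists_labels_iff P x y S) rfl rfl

/-! ### Sums over quadruples as sums over pairs -/

section
variable {β M : Type} [AddCommMonoid M]

/-- Along a sorted list the summands need to agree only on arguments in sorted position, which is
where the counting formulas hold. -/
theorem sumPairs_congr {R : β → β → Prop} {f f' : Multiset β → β → β → M}
    (h : ∀ pre p q, (∀ b ∈ pre, R b p ∧ R b q) → R p q → f pre p q = f' pre p q) (l : List β)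
    (hl : l.Pairwise R) (pre : Multiset β) (hpre : ∀ b ∈ pre, ∀ p ∈ l, R b p) :
    sumPairs f l pre = sumPairs f' l pre := by
  induction l generalizing pre with
  | nil => rfl
  | cons p l ih =>
    obtain ⟨h₁, h₂⟩ := List.pairwise_cons.1 hl
    rw [sumPairs, sumPairs, ih h₂]
    · congr 2
      refine List.map_congr_left fun q hq => h _ _ _ (fun b hb => ⟨?_, ?_⟩) (h₁ q hq)
      · exact hpre b hb p List.mem_cons_self
      · exact hpre b hb q (List.mem_cons_of_mem _ hq)
    · intro b hb q hq
      obtain rfl | hb := Multiset.mem_cons.1 hb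
      · exact h₁ q hq
      · exact hpre b hb q (List.mem_cons_of_mem _ hq)

theorem sum_powersetCard_succ_cons (g : Multiset β → M) (k : ℕ) (b : β) (s : Multiset β) :
    ((Multiset.powersetCard (k + 1) (b ::ₘ s)).map g).sum =
      ((Multiset.powersetCard (k + 1) s).map g).sum +
        ((Multiset.powersetCard k s).map fun T => g (b ::ₘ T)).sum := by
  rw [Multiset.powersetCard_cons, Multiset.map_add, Multiset.sum_add, Multiset.map_map]
  rfl

/-- Four-subsets of `pre + l` are split by how many elements lie in `l`: at least two (then `p`, `q`
are the last two), none, or exactly one. The form with `pre` makes the induction close. -/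
theorem sum_powersetCard_four_add (g : Multiset β → M) (l : List β) (pre : Multiset β) :
    sumPairs (fun pre p q =>
        ((Multiset.powersetCard 2 pre).map fun T => g (q ::ₘ p ::ₘ T)).sum) l pre +
      ((Multiset.powersetCard 4 pre).map g).sum +
      (l.map fun q => ((Multiset.powersetCard 3 pre).map fun T => g (q ::ₘ T)).sum).sum =
    ((Multiset.powersetCard 4 (pre + (l : Multiset β))).map g).sum := by
  induction l generalizing pre with
  | nil => simp [sumPairs]
  | cons p l ih =>
    have e : pre + ((p :: l : List β) : Multiset β) = (p ::ₘ pre) + l := by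
      rw [← Multiset.cons_coe, Multiset.add_cons, Multiset.cons_add]
    rw [e, ← ih, sumPairs, sum_powersetCard_succ_cons g 3]
    simp only [sum_powersetCard_succ_cons _ 2, List.sum_map_add, List.map_cons, List.sum_cons]
    abel

theorem sum_powersetCard_four (g : Multiset β → M) (l : List β) :
    ((Multiset.powersetCard 4 (l : Multiset β)).map g).sum =
      sumPairs (fun pre p q =>
        ((Multiset.powersetCard 2 pre).map fun T => g (q ::ₘ p ::ₘ T)).sum) l 0 := by
  simpa [Multiset.powersetCard_zero_right] using (sum_powersetCard_four_add g l 0).symm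

end

open Classical in
/-- A recursion for the number of pairs of points with first coordinate different from `x` whose
second coordinates satisfy `Q`. -/
theorem sum_powersetCard_two (g : Multiset (ℝ × ℝ) → ℕ) (x : ℝ) (Q : ℝ → ℝ → Prop)
    (G : Multiset ℝ → ℕ) (G_zero : G 0 = 0) (G_cons : ∀ y K, G (y ::ₘ K) = G K + K.countP (Q y))
    (pre : Multiset (ℝ × ℝ))
    (hg : ∀ p ∈ pre, ∀ q ∈ pre, g {p, q} = if p.1 ≠ x ∧ q.1 ≠ x ∧ Q p.2 q.2 then 1 else 0) :
    ((Multiset.powersetCard 2 pre).map g).sum = G (keysApart x pre) := by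
  induction pre using Multiset.induction_on with
  | empty => simp [keysApart, G_zero, Multiset.powersetCard_zero_right]
  | cons p pre ih =>
    rw [sum_powersetCard_succ_cons, ih fun u hu v hv =>
      hg u (Multiset.mem_cons_of_mem hu) v (Multiset.mem_cons_of_mem hv)]
    rw [Multiset.powersetCard_one, Multiset.map_map]
    have e : (pre.map ((fun T => g (p ::ₘ T)) ∘ singleton)) =
        pre.map fun q => if p.1 ≠ x ∧ q.1 ≠ x ∧ Q p.2 q.2 then 1 else 0 :=
      Multiset.map_congr rfl fun q hq => hg p (Multiset.mem_cons_self _ _) q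
        (Multiset.mem_cons_of_mem hq)
    rw [e]
    have key : ∀ s : Multiset (ℝ × ℝ),
        (s.map fun q => if q.1 ≠ x ∧ Q p.2 q.2 then 1 else 0).sum =
          (keysApart x s).countP (Q p.2) := fun s => by
      induction s using Multiset.induction_on with
      | empty => simp [keysApart]
      | cons b s ih =>
        rw [Multiset.map_cons, Multiset.sum_cons, ih]
        by_cases hb : b.1 = x
        · simp [keysApart, hb]
        · simp [keysApart, hb, Multiset.countP_cons, add_comm]
    by_cases hp : p.1 = x
    · simp [keysApart, hp]
    · have : keysApart x (p ::ₘ pre) = p.2 ::ₘ keysApart x pre := by simp [keysApart, hp]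
      rw [this, G_cons, ← key]
      simp [hp]

theorem eq_or_eq_of_pair_eq {β : Type} {a b c d : β}
    (h : a ::ₘ b ::ₘ (0 : Multiset β) = c ::ₘ d ::ₘ 0) : a = c ∧ b = d ∨ a = d ∧ b = c := by
  have ha : a ∈ c ::ₘ d ::ₘ (0 : Multiset β) := h ▸ Multiset.mem_cons_self _ _
  simp only [Multiset.mem_cons, Multiset.notMem_zero, or_false] at ha
  obtain rfl | rfl := ha
  · simp_all
  · rw [Multiset.cons_swap c] at h
    simp_all

/-- Ties allow several ascending labellings. If the middle first coordinates differ, the left pair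
and the right pair are nevertheless determined as sets, and `Q` is symmetric within each pair. -/
theorem quad_iff {P : (Fin 4 → ℝ) → (Fin 4 → ℝ) → Prop} {Q : ℝ → ℝ → ℝ → ℝ → Prop}
    (hP : ∀ u v : Fin 4 → ℝ, P u v ↔ u 1 ≠ u 2 ∧ Q (v 0) (v 1) (v 2) (v 3))
    (hl : ∀ a b c d, Q a b c d → Q b a c d) (hr : ∀ a b c d, Q a b c d → Q a b d c)
    {a b c d : ℝ × ℝ} (hac : a.1 ≤ c.1) (had : a.1 ≤ d.1) (hbc : b.1 ≤ c.1) (hbd : b.1 ≤ d.1) :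
    Quad P {a, b, c, d} ↔
      (a.1 ≠ c.1 ∧ a.1 ≠ d.1 ∧ b.1 ≠ c.1 ∧ b.1 ≠ d.1) ∧ Q a.2 b.2 c.2 d.2 := by
  constructor
  · rintro ⟨u, v, e, ⟨h₁, h₂, h₃⟩, h⟩
    rw [hP] at h
    have h₂ := lt_of_le_of_ne h₂ h.1
    -- Cutting at `u 1` leaves exactly two points on either side; cardinalities then identify the
    -- left two as `a`, `b`.
    have e₁ := congrArg (Multiset.filter fun p => p.1 ≤ u 1) e
    have e₂ := congrArg (Multiset.filter fun p => ¬ p.1 ≤ u 1) e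
    simp only [Multiset.insert_eq_cons, ← Multiset.cons_zero, Multiset.filter_cons,
      Multiset.filter_zero] at e₁ e₂
    rw [if_pos h₁, if_pos le_rfl, if_neg h₂.not_ge, if_neg (h₂.trans_le h₃).not_ge] at e₁
    rw [if_neg (not_not.2 h₁), if_neg (not_not.2 le_rfl), if_pos h₂.not_ge,
      if_pos (h₂.trans_le h₃).not_ge] at e₂
    have hc : ¬ c.1 ≤ u 1 := by
      intro hc
      rw [if_pos hc, if_pos (hac.trans hc), if_pos (hbc.trans hc)] at e₁
      have := congrArg Multiset.card e₁
      split_ifs at this <;> simp at this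
    have hd : ¬ d.1 ≤ u 1 := by
      intro hc
      rw [if_pos hc, if_pos (had.trans hc), if_pos (hbd.trans hc)] at e₁
      have := congrArg Multiset.card e₁
      split_ifs at this; simp at this
    have ha : a.1 ≤ u 1 := by
      by_contra ha
      rw [if_pos ha, if_pos hc, if_pos hd] at e₂
      have := congrArg Multiset.card e₂
      split_ifs at this <;> simp at this
    have hb : b.1 ≤ u 1 := by
      by_contra ha
      rw [if_pos ha, if_pos hc, if_pos hd] at e₂
      have := congrArg Multiset.card e₂
      split_ifs at this ; simp at this
    refine ⟨⟨?_, ?_, ?_, ?_⟩, ?_⟩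
    · exact fun e => hc (e ▸ ha)
    · exact fun e => hd (e ▸ ha)
    · exact fun e => hc (e ▸ hb)
    · exact fun e => hd (e ▸ hb)
    rw [if_pos ha, if_pos hb, if_neg hc, if_neg hd] at e₁
    rw [if_neg (not_not.2 ha), if_neg (not_not.2 hb), if_pos hc, if_pos hd] at e₂
    have f₁ := congrArg (Multiset.map Prod.snd) e₁
    have f₂ := congrArg (Multiset.map Prod.snd) e₂
    simp only [Multiset.map_cons, Multiset.map_zero, Multiset.cons_add, zero_add,
      add_zero] at f₁ f₂
    obtain ⟨e₀, e₁⟩ | ⟨e₀, e₁⟩ := eq_or_eq_of_pair_eq f₁ <;>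
    obtain ⟨e₂, e₃⟩ | ⟨e₂, e₃⟩ := eq_or_eq_of_pair_eq f₂ <;> rw [e₀, e₁, e₂, e₃]
    exacts [h.2, hr _ _ _ _ h.2, hl _ _ _ _ h.2, hl _ _ _ _ (hr _ _ _ _ h.2)]
  · rintro ⟨⟨n₁, n₂, n₃, n₄⟩, h⟩
    have key : ∀ {a b c d : ℝ × ℝ}, a.1 ≤ b.1 → b.1 ≤ c.1 → c.1 ≤ d.1 → b.1 ≠ c.1 →
        Q a.2 b.2 c.2 d.2 → Quad P {a, b, c, d} := fun {a b c d} h₁ h₂ h₃ hn h =>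
      ⟨![a.1, b.1, c.1, d.1], ![a.2, b.2, c.2, d.2], rfl, ⟨h₁, h₂, h₃⟩, (hP _ _).2 ⟨hn, h⟩⟩
    have swap_left : ∀ a b c d : ℝ × ℝ, ({a, b, c, d} : Multiset (ℝ × ℝ)) = {b, a, c, d} :=
      fun a b c d => Multiset.cons_swap _ _ _
    have swap_right : ∀ a b c d : ℝ × ℝ, ({a, b, c, d} : Multiset (ℝ × ℝ)) = {a, b, d, c} :=
      fun a b c d => congrArg (fun s => a ::ₘ b ::ₘ s) (Multiset.pair_comm c d)
    obtain hab | hab := le_total a.1 b.1 <;> obtain hcd | hcd := le_total c.1 d.1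
    · exact key hab hbc hcd n₃ h
    · rw [swap_right]
      exact key hab hbd hcd n₄ (hr _ _ _ _ h)
    · rw [swap_left]
      exact key hab hac hcd n₁ (hl _ _ _ _ h)
    · rw [swap_left, swap_right]
      exact key hab had hcd n₂ (hl _ _ _ _ (hr _ _ _ _ h))

/-! ### Counting pairs of keys -/

section
variable {α : Type} [LinearOrder α] {m M : α} (h : m < M) (K : Multiset α)
include h

theorem countP_gt_eq : K.countP (m < ·) =
    K.countP (M < ·) + K.countP (fun b => m < b ∧ b < M) + K.countP (· = M) := by
  induction K using Multiset.induction_on with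
  | empty => simp
  | cons b K ih =>
    simp only [Multiset.countP_cons, ih]
    obtain hb | rfl | hb := lt_trichotomy b M
    · by_cases hm : m < b <;> simp [hb, hb.ne, hb.not_gt, hm]
      omega
    · simp [h]
      omega
    · simp [hb, hb.ne', hb.not_gt, h.trans hb]
      omega

theorem countP_lt_eq : K.countP (· < M) =
    K.countP (· < m) + K.countP (fun b => m < b ∧ b < M) + K.countP (· = m) := by
  induction K using Multiset.induction_on with
  | empty => simp
  | cons b K ih =>
    simp only [Multiset.countP_cons, ih]
    obtain hb | rfl | hb := lt_trichotomy b m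
    · simp [hb, hb.ne, hb.not_gt, hb.trans h]
      omega
    · simp [h]
      omega
    · by_cases hm : b < M <;> simp [hb, hb.ne', hb.not_gt, hm]
      omega

theorem card_eq_countP_add : K.card =
    K.countP (· < m) + K.countP (· = m) + K.countP (m < ·) := by
  induction K using Multiset.induction_on with
  | empty => simp
  | cons b K ih =>
    simp only [Multiset.countP_cons, Multiset.card_cons, ih]
    obtain hb | rfl | hb := lt_trichotomy b m
    · simp [hb, hb.ne, hb.not_gt]
      omega
    · simp
      omega
    · simp [hb, hb.ne', hb.not_gt]
      omega
end

/-- Concordance of second coordinates, the first two belonging to the points on the left. -/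
def ConcordantValues (a b c d : ℝ) : Prop := max a b < min c d ∨ max c d < min a b

/-- Discordance of second coordinates, the first two belonging to the points on the left. -/
def DiscordantValues (a b c d : ℝ) : Prop :=
  max (min a b) (min c d) ≠ min (max a b) (max c d) ∧ min c d < max a b ∧ min a b < max c d

/-- Over-counting of second coordinates, the first two belonging to the points on the left. -/
def OvercountedValues (a b c d : ℝ) : Prop := a = b ∧ min c d < a ∧ a < max c d

/-- Suppose the two middle values coincide although the strict inequalities on the right hold. Then
this common value lies strictly between `c` and `d`, so it is both the minimum and the maximum of
`a`, `b`, which is over-counting. -/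
theorem discordantValues_or_overcountedValues (a b c d : ℝ) :
    DiscordantValues a b c d ∨ OvercountedValues a b c d ↔
      c ≠ d ∧ min c d < max a b ∧ min a b < max c d := by
  unfold DiscordantValues OvercountedValues
  constructor
  · rintro (⟨h, h₁, h₂⟩ | ⟨rfl, h₁, h₂⟩)
    · refine ⟨?_, h₁, h₂⟩
      rintro rfl
      simp only [max_self, min_self] at h h₁ h₂
      exact h (by rw [max_eq_right h₂.le, min_eq_right h₁.le])
    · exact ⟨min_lt_max.1 (h₁.trans h₂), by simpa using h₁, by simpa using h₂⟩
  · rintro ⟨hcd, h₁, h₂⟩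
    refine or_iff_not_imp_left.2 fun h => ?_
    have h : max (min a b) (min c d) = min (max a b) (max c d) := by tauto
    have h₃ : min c d < max (min a b) (min c d) := h ▸ lt_min h₁ (min_lt_max.2 hcd)
    have h₄ : min (max a b) (max c d) < max c d := h ▸ max_lt h₂ (min_lt_max.2 hcd)
    have h₃ : min c d < min a b := (lt_max_iff.1 h₃).resolve_right (lt_irrefl _)
    have h₄ : max a b < max c d := (min_lt_iff.1 h₄).resolve_right (lt_irrefl _)
    rw [max_eq_left h₃.le, min_eq_left h₄.le] at h
    obtain rfl : a = b := by
      by_contra hab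
      exact (min_lt_max.2 hab).ne h
    simp only [max_self, min_self] at h₃ h₄
    exact ⟨rfl, h₃, h₄⟩

theorem not_discordantValues_and_overcountedValues (a b c d : ℝ) :
    ¬ (DiscordantValues a b c d ∧ OvercountedValues a b c d) := by
  rintro ⟨⟨h, -⟩, rfl, h₁, h₂⟩
  exact h (by simp [h₁.le, h₂.le])

/-! ### Increments of the pair counts when a key is added. -/

theorem choose_two_succ (k : ℕ) : (k + 1).choose 2 = k.choose 2 + k := by
  rw [Nat.choose_succ_succ' k 1, Nat.choose_one_right, add_comm]

open Classical in
-- A key below both values pairs with the keys below, a key above both with the keys above, any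
-- other key with none.
theorem concordantCount_cons (c d b : ℝ) (K : Multiset ℝ) :
    concordantCount (b ::ₘ K) c d =
      concordantCount K c d + K.countP fun a => ConcordantValues b a c d := by
  have hle : min c d ≤ max c d := min_le_max
  obtain h | h := lt_or_ge b (min c d)
  · have : K.countP (fun a => ConcordantValues b a c d) = K.countP (· < min c d) := by
      refine Multiset.countP_congr rfl fun a _ => propext ?_
      rw [ConcordantValues, max_lt_iff, lt_min_iff (a := max c d)]
      simp only [ h, (h.trans_le hle).not_gt, true_and, false_and, or_false]
    simp only [concordantCount, this, Multiset.countP_cons, h, (h.trans_le hle).not_gt, if_true, if_false,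
      choose_two_succ, add_zero, add_assoc]
  obtain h' | h' := lt_or_ge (max c d) b
  · have : K.countP (fun a => ConcordantValues b a c d) = K.countP (max c d < ·) := by
      refine Multiset.countP_congr rfl fun a _ => propext ?_
      rw [ConcordantValues, max_lt_iff, lt_min_iff (a := max c d)]
      simp only [ h', h.not_gt, true_and, false_and, false_or]
    simp only [concordantCount, this, Multiset.countP_cons, h', h.not_gt, if_true, if_false,
      choose_two_succ, add_zero]
    ring
  · have : K.countP (fun a => ConcordantValues b a c d) = 0 := by
      refine Multiset.countP_eq_zero.2 fun a _ => ?_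
      rw [ConcordantValues, max_lt_iff, lt_min_iff (a := max c d)]
      simp only [ h'.not_gt, h.not_gt, false_and, or_false, not_false_iff]
    simp only [concordantCount, this, Multiset.countP_cons, h'.not_gt, h.not_gt, if_false, add_zero]

open Classical in
-- With `m < M` the two values, a new key `b ≤ m` pairs with all keys above `m`, `m < b < M` with
-- every key, and `b ≥ M` with all keys below `M`. The polynomial has these increments in each of
-- the five positions of `b`.
theorem discordantCount_cons (c d b : ℝ) (K : Multiset ℝ) :
    discordantCount (b ::ₘ K) c d = discordantCount K c d +
      K.countP fun a => c ≠ d ∧ min c d < max b a ∧ min b a < max c d := by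
  obtain rfl | hcd := eq_or_ne c d
  · simp [discordantCount]
  have h : min c d < max c d := min_lt_max.2 hcd
  simp only [discordantCount, hcd, if_false, ne_eq, not_false_iff, true_and]
  generalize min c d = m at *
  generalize max c d = M at *
  have h₁ := countP_gt_eq h K
  have h₂ := countP_lt_eq h K
  have h₃ := card_eq_countP_add h K
  obtain hm | hm := le_or_gt b m
  · have hM := hm.trans_lt h
    have : K.countP (fun a => m < max b a ∧ min b a < M) = K.countP (m < ·) := by
      refine Multiset.countP_congr rfl fun a _ => propext ?_
      simp only [lt_max_iff, min_lt_iff, hm.not_gt, hM, true_or, and_true, false_or]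
    rw [this, h₁]
    obtain hm | rfl := hm.lt_or_eq
    · simp only [Multiset.countP_cons, hm, hM, hm.not_gt, hM.not_gt, hm.ne, hM.ne, if_true,
        if_false, false_and, add_zero]
      ring
    · simp only [Multiset.countP_cons, hM, hM.not_gt, hM.ne, lt_irrefl, if_true,
        if_false, false_and, add_zero]
      ring
  obtain hM | hM := lt_or_ge b M
  · have : K.countP (fun a => m < max b a ∧ min b a < M) = K.card := by
      refine Multiset.countP_eq_card.2 fun a _ => ?_
      simp only [lt_max_iff, min_lt_iff, hm, hM, true_or, and_true]
    rw [this, h₃, h₁]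
    simp only [Multiset.countP_cons, hm, hM, hm.not_gt, hM.not_gt, hm.ne', hM.ne, if_true,
      if_false, and_true, add_zero, choose_two_succ]
    ring
  · have : K.countP (fun a => m < max b a ∧ min b a < M) = K.countP (· < M) := by
      refine Multiset.countP_congr rfl fun a _ => propext ?_
      simp only [lt_max_iff, min_lt_iff, hm, hM.not_gt, true_or, true_and, false_or]
    rw [this, h₂]
    obtain hM | rfl := hM.lt_or_eq
    · simp only [Multiset.countP_cons, hm, hM, hm.not_gt, hM.not_gt, hm.ne', hM.ne', if_true,
        if_false, and_false, add_zero]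
      ring
    · simp only [Multiset.countP_cons, hm, hm.not_gt, hm.ne', lt_irrefl, if_true,
        if_false, and_false, add_zero]
      ring

open Classical in
-- The keys now belong to the right points, hence the order of arguments. A pair of keys counts if
-- it straddles the common value of the left points.
theorem overcountedCount_cons (c d b : ℝ) (K : Multiset ℝ) :
    overcountedCount (b ::ₘ K) c d =
      overcountedCount K c d + K.countP fun a => OvercountedValues c d b a := by
  obtain rfl | hcd := eq_or_ne c d
  · obtain h | rfl | h := lt_trichotomy b c
    · have : K.countP (fun a => OvercountedValues c c b a) = K.countP (c < ·) := by
        refine Multiset.countP_congr rfl fun a _ => propext ?_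
        simp [OvercountedValues, h, h.not_gt]
      simp only [overcountedCount, this, Multiset.countP_cons, h, h.not_gt, if_true, if_false]
      ring
    · have : K.countP (fun a => OvercountedValues b b b a) = 0 := by
        refine Multiset.countP_eq_zero.2 fun a _ => ?_
        simp only [OvercountedValues, min_lt_iff, lt_max_iff, lt_irrefl, false_or, true_and]
        exact fun h => lt_asymm h.1 h.2
      simp only [overcountedCount, this, Multiset.countP_cons, lt_irrefl, if_true, if_false,
        add_zero]
    · have : K.countP (fun a => OvercountedValues c c b a) = K.countP (· < c) := by
        refine Multiset.countP_congr rfl fun a _ => propext ?_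
        simp [OvercountedValues, h, h.not_gt]
      simp only [overcountedCount, this, Multiset.countP_cons, h, h.not_gt, if_true, if_false]
      ring
  · simp [overcountedCount, OvercountedValues, hcd]

/-! ### The sum over the 24 orders of four points. -/

theorem map_univ_perm_fin_four :
    (Finset.univ : Finset (Equiv.Perm (Fin 4))).val.map (fun π => (π 0, π 1, π 2, π 3)) =
      {(0, 1, 2, 3), (0, 1, 3, 2), (0, 2, 1, 3), (0, 2, 3, 1), (0, 3, 1, 2), (0, 3, 2, 1),
        (1, 0, 2, 3), (1, 0, 3, 2), (1, 2, 0, 3), (1, 2, 3, 0), (1, 3, 0, 2), (1, 3, 2, 0),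
        (2, 0, 1, 3), (2, 0, 3, 1), (2, 1, 0, 3), (2, 1, 3, 0), (2, 3, 0, 1), (2, 3, 1, 0),
        (3, 0, 1, 2), (3, 0, 2, 1), (3, 1, 0, 2), (3, 1, 2, 0), (3, 2, 0, 1), (3, 2, 1, 0)} := by
  decide

/-- The sum of the signs of the differences between the pairing `a b | c d` and the other two
pairings of four numbers. -/
noncomputable def pairingSign (a b c d : ℝ) : ℝ :=
  Real.sign (|a - b| + |c - d| - |a - c| - |b - d|) +
    Real.sign (|a - b| + |c - d| - |a - d| - |b - c|)

/-- Each factor depends only on an ordered pair of distinct pairings, and each of the six such pairs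
arises from four permutations. The first factor vanishes unless 01|23 is involved; reversing a pair
negates both factors. -/
theorem sum_perm_a_mul_a (u v : Fin 4 → ℝ) (h₁ : u 0 ≤ u 1) (h₂ : u 1 ≤ u 2) (h₃ : u 2 ≤ u 3) :
    ∑ π : Equiv.Perm (Fin 4), a (u (π 0)) (u (π 1)) (u (π 2)) (u (π 3)) *
      a (v (π 0)) (v (π 1)) (v (π 2)) (v (π 3)) =
    -8 * Real.sign (u 2 - u 1) * pairingSign (v 0) (v 1) (v 2) (v 3) := by
  have e : ∑ π : Equiv.Perm (Fin 4), a (u (π 0)) (u (π 1)) (u (π 2)) (u (π 3)) *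
      a (v (π 0)) (v (π 1)) (v (π 2)) (v (π 3)) =
      (((Finset.univ : Finset (Equiv.Perm (Fin 4))).val.map (fun π => (π 0, π 1, π 2, π 3))).map
        fun t => a (u t.1) (u t.2.1) (u t.2.2.1) (u t.2.2.2) *
          a (v t.1) (v t.2.1) (v t.2.2.1) (v t.2.2.2)).sum := by
    rw [Multiset.map_map]
    rfl
  rw [e, map_univ_perm_fin_four]
  simp only [Multiset.insert_eq_cons, Multiset.map_cons, Multiset.sum_cons, Multiset.map_singleton,
    Multiset.sum_singleton, a, pairingSign]
  have hc : ∀ s t : ℝ, |s - t| = |t - s| := abs_sub_comm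
  have h2 : ∀ t : ℝ, Real.sign (t * 2) = Real.sign t := fun t => by
    obtain h | rfl | h := lt_trichotomy t 0
    · rw [Real.sign_of_neg h, Real.sign_of_neg (by linarith)]
    · simp
    · rw [Real.sign_of_pos h, Real.sign_of_pos (by linarith)]
  have k₁ : |u 0 - u 1| = u 1 - u 0 := by rw [hc]; exact abs_of_nonneg (by linarith)
  have k₂ : |u 0 - u 2| = u 2 - u 0 := by rw [hc]; exact abs_of_nonneg (by linarith)
  have k₃ : |u 0 - u 3| = u 3 - u 0 := by rw [hc]; exact abs_of_nonneg (by linarith)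
  have k₄ : |u 1 - u 2| = u 2 - u 1 := by rw [hc]; exact abs_of_nonneg (by linarith)
  have k₅ : |u 1 - u 3| = u 3 - u 1 := by rw [hc]; exact abs_of_nonneg (by linarith)
  have k₆ : |u 2 - u 3| = u 3 - u 2 := by rw [hc]; exact abs_of_nonneg (by linarith)
  simp only [hc (u 1) (u 0), hc (u 2) (u 0), hc (u 3) (u 0), hc (u 2) (u 1), hc (u 3) (u 1),
    hc (u 3) (u 2), hc (v 1) (v 0), hc (v 2) (v 0), hc (v 3) (v 0), hc (v 2) (v 1), hc (v 3) (v 1),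
    hc (v 3) (v 2), k₁, k₂, k₃, k₄, k₅, k₆]
  generalize |v 0 - v 1| = p₁
  generalize |v 2 - v 3| = p₂
  generalize |v 0 - v 2| = q₁
  generalize |v 1 - v 3| = q₂
  generalize |v 0 - v 3| = r₁
  generalize |v 1 - v 2| = r₂
  ring_nf
  -- Normalisation leaves signs of opposite or doubled arguments; they are reduced to common ones.
  have e₁ : (u 1 * 2 - u 2 * 2).sign = -(-u 1 + u 2).sign := by
    rw [← Real.sign_neg, ← h2 (-(-u 1 + u 2))]
    ring_nf
  have e₂ : (-(u 1 * 2) + u 2 * 2).sign = (-u 1 + u 2).sign := by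
    rw [← h2 (-u 1 + u 2)]
    ring_nf
  have e₃ : (-p₁ - p₂ + q₁ + q₂).sign = -(p₁ + p₂ - q₁ - q₂).sign := by
    rw [← Real.sign_neg]
    ring_nf
  have e₄ : (-p₁ - p₂ + r₁ + r₂).sign = -(p₁ + p₂ - r₁ - r₂).sign := by
    rw [← Real.sign_neg]
    ring_nf
  rw [e₁, e₂, e₃, e₄, Real.sign_zero]
  ring

open Classical in
-- If the intervals `[a, b]` and `[c, d]` are disjoint, both signs are -1. If they meet, one
-- comparison is an equality and the other gives twice the length of the overlap, which is positive
-- exactly for discordant values.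
theorem pairingSign_of_le {a b c d : ℝ} (hab : a ≤ b) (hcd : c ≤ d) :
    pairingSign a b c d =
      (if DiscordantValues a b c d then 1 else 0) -
        2 * (if ConcordantValues a b c d then 1 else 0) := by
  have h₁ : |a - b| = b - a := by rw [abs_sub_comm]; exact abs_of_nonneg (by linarith)
  have h₂ : |c - d| = d - c := by rw [abs_sub_comm]; exact abs_of_nonneg (by linarith)
  unfold pairingSign DiscordantValues ConcordantValues
  simp only [h₁, h₂, max_eq_right hab, min_eq_left hab, max_eq_right hcd, min_eq_left hcd]
  obtain hbc | hbc := lt_or_ge b c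
  · rw [if_neg (fun h => hbc.not_gt h.2.1), if_pos (Or.inl hbc),
      abs_of_nonpos (by linarith : a - c ≤ 0), abs_of_nonpos (by linarith : b - d ≤ 0),
      abs_of_nonpos (by linarith : a - d ≤ 0), abs_of_nonpos (by linarith : b - c ≤ 0),
      Real.sign_of_neg (by linarith), Real.sign_of_neg (by linarith)]
    norm_num
  obtain hda | hda := lt_or_ge d a
  · rw [if_neg (fun h => hda.not_gt h.2.2), if_pos (Or.inr hda),
      abs_of_nonneg (by linarith : 0 ≤ a - c), abs_of_nonneg (by linarith : 0 ≤ b - d),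
      abs_of_nonneg (by linarith : 0 ≤ a - d), abs_of_nonneg (by linarith : 0 ≤ b - c),
      Real.sign_of_neg (by linarith), Real.sign_of_neg (by linarith)]
    norm_num
  rw [if_neg (not_or.2 ⟨hbc.not_gt, hda.not_gt⟩), abs_of_nonpos (by linarith : a - d ≤ 0),
    abs_of_nonneg (by linarith : 0 ≤ b - c),
    (by ring : b - a + (d - c) - -(a - d) - (b - c) = 0), Real.sign_zero]
  have e : b - a + (d - c) - |a - c| - |b - d| = 2 * (min b d - max a c) := by
    rw [abs_sub_comm b, ← max_sub_min_eq_abs' a c, ← max_sub_min_eq_abs' d b]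
    linarith [max_add_min a c, max_add_min d b, min_comm b d]
  rw [e]
  have hle : max a c ≤ min b d := max_le (le_min hab hda) (le_min hbc hcd)
  obtain h | h := hle.lt_or_eq
  · rw [if_pos ⟨h.ne, ((le_max_right _ _).trans_lt h).trans_le (min_le_left _ _),
      ((le_max_left _ _).trans_lt h).trans_le (min_le_right _ _)⟩, Real.sign_of_pos (by linarith)]
    norm_num
  · rw [if_neg fun h' => h'.1 h, h]
    simp

open Classical in
theorem pairingSign_eq (a b c d : ℝ) :
    pairingSign a b c d =
      (if DiscordantValues a b c d then 1 else 0) -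
        2 * (if ConcordantValues a b c d then 1 else 0) := by
  have hl : ∀ {a b c d : ℝ}, pairingSign a b c d = pairingSign b a c d := fun {a b c d} => by
    simp only [pairingSign, abs_sub_comm b a]
    rw [add_comm]
    congr 2 <;> ring
  have hr : ∀ {a b c d : ℝ}, pairingSign a b c d = pairingSign a b d c := fun {a b c d} => by
    simp only [pairingSign, abs_sub_comm d c]
    exact add_comm _ _
  obtain hab | hab := le_total a b <;> obtain hcd | hcd := le_total c d
  · exact pairingSign_of_le hab hcd
  · rw [hr, pairingSign_of_le hab hcd, DiscordantValues, ConcordantValues, DiscordantValues,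
      ConcordantValues, max_comm d c, min_comm d c]
  · rw [hl, pairingSign_of_le hab hcd, DiscordantValues, ConcordantValues, DiscordantValues,
      ConcordantValues, max_comm b a, min_comm b a]
  · rw [hl, hr, pairingSign_of_le hab hcd, DiscordantValues, ConcordantValues, DiscordantValues,
      ConcordantValues, max_comm b a, min_comm b a, max_comm d c, min_comm d c]

/-! ### Inseparability -/

theorem exists_perm_of_injective {v : Fin 4 → ℝ} {i j k l : Fin 4}
    (h : Function.Injective ![i, j, k, l]) (h₁ : v i ≤ v j) (h₂ : v j = v k) (h₃ : v k ≤ v l) :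
    ∃ π : Equiv.Perm (Fin 4), v (π 0) ≤ v (π 1) ∧ v (π 1) = v (π 2) ∧ v (π 2) ≤ v (π 3) :=
  ⟨Equiv.ofBijective _ (Finite.injective_iff_bijective.1 h), h₁, h₂, h₃⟩

/-- The smaller of the two minima is least and the larger of the two maxima greatest, so the
remaining minimum and maximum are the two middle values. -/
theorem exists_perm_iff (v : Fin 4 → ℝ) :
    (∃ π : Equiv.Perm (Fin 4), v (π 0) ≤ v (π 1) ∧ v (π 1) = v (π 2) ∧ v (π 2) ≤ v (π 3)) ↔
      max (min (v 0) (v 1)) (min (v 2) (v 3)) = min (max (v 0) (v 1)) (max (v 2) (v 3)) := by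
  constructor
  · rintro ⟨π, h₁, h₂, h₃⟩
    -- All values but one are at least the common middle value and all but one at most, so each pair
    -- contains a value on either side and one pair lies wholly on it.
    have hlow : ∀ m, m ≠ π 0 → v (π 1) ≤ v m := fun m hm => by
      obtain ⟨k, rfl⟩ := π.surjective m
      fin_cases k
      exacts [absurd rfl hm, le_rfl, h₂.le, h₂.le.trans h₃]
    have hhigh : ∀ m, m ≠ π 3 → v m ≤ v (π 1) := fun m hm => by
      obtain ⟨k, rfl⟩ := π.surjective m
      fin_cases k
      exacts [h₁, le_rfl, h₂.ge, absurd rfl hm]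
    have e₁ : max (min (v 0) (v 1)) (min (v 2) (v 3)) = v (π 1) := by
      generalize π 0 = i at *
      generalize π 3 = j at *
      generalize v (π 1) = t at *
      refine le_antisymm ?_ ?_
      · simp only [max_le_iff, min_le_iff]
        fin_cases j <;> simp [hhigh]
      · simp only [le_max_iff, le_min_iff]
        fin_cases i <;> simp [hlow]
    have e₂ : min (max (v 0) (v 1)) (max (v 2) (v 3)) = v (π 1) := by
      generalize π 0 = i at *
      generalize π 3 = j at *
      generalize v (π 1) = t at *
      refine le_antisymm ?_ ?_
      · simp only [max_le_iff, min_le_iff]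
        fin_cases j <;> simp [hhigh]
      · simp only [le_max_iff, le_min_iff]
        fin_cases i <;> simp [hlow]
    rw [e₁, e₂]
  · have key : ∀ {i j k l : Fin 4}, Function.Injective ![i, j, k, l] → v i ≤ v j → v k ≤ v l →
        max (v i) (v k) = min (v j) (v l) →
        ∃ π : Equiv.Perm (Fin 4), v (π 0) ≤ v (π 1) ∧ v (π 1) = v (π 2) ∧ v (π 2) ≤ v (π 3) := by
      intro i j k l hinj hij hkl h
      have hperm : ∀ i j k l : Fin 4, Function.Injective ![i, j, k, l] →
          Function.Injective ![i, k, j, l] ∧ Function.Injective ![i, k, l, j] ∧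
            Function.Injective ![k, i, j, l] ∧ Function.Injective ![k, i, l, j] := by decide
      obtain ⟨p₁, p₂, p₃, p₄⟩ := hperm i j k l hinj
      obtain h₁ | h₁ := le_total (v i) (v k) <;> obtain h₂ | h₂ := le_total (v j) (v l) <;>
        simp only [h₁, h₂, max_eq_left, max_eq_right, min_eq_left, min_eq_right] at h
      · exact exists_perm_of_injective p₁ h₁ h h₂
      · exact exists_perm_of_injective p₂ h₁ h h₂
      · exact exists_perm_of_injective p₃ h₁ h h₂
      · exact exists_perm_of_injective p₄ h₁ h h₂
    intro h
    obtain h₁ | h₁ := le_total (v 0) (v 1) <;> obtain h₂ | h₂ := le_total (v 2) (v 3) <;>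
      simp only [h₁, h₂, max_eq_left, max_eq_right, min_eq_left, min_eq_right] at h
    · exact key (i := 0) (j := 1) (k := 2) (l := 3) (by decide) h₁ h₂ h
    · exact key (i := 0) (j := 1) (k := 3) (l := 2) (by decide) h₁ h₂ h
    · exact key (i := 1) (j := 0) (k := 2) (l := 3) (by decide) h₁ h₂ h
    · exact key (i := 1) (j := 0) (k := 3) (l := 2) (by decide) h₁ h₂ h

theorem inseparable_iff (u v : Fin 4 → ℝ) :
    Inseparable u v ↔ u 1 = u 2 ∨
      max (min (v 0) (v 1)) (min (v 2) (v 3)) = min (max (v 0) (v 1)) (max (v 2) (v 3)) := by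
  rw [Inseparable, exists_perm_iff]

theorem concordant_iff (u v : Fin 4 → ℝ) :
    Concordant u v ↔ u 1 ≠ u 2 ∧ ConcordantValues (v 0) (v 1) (v 2) (v 3) := by
  rw [Concordant, inseparable_iff, not_or, ConcordantValues, and_assoc, and_congr_right_iff]
  -- Strict separation of the pairs already makes the middle values distinct.
  refine fun _ => ⟨fun h => h.2, fun h => ⟨?_, h⟩⟩
  obtain h | h := h
  · rw [max_eq_right (min_le_max.trans h.le), min_eq_left (h.le.trans min_le_max)]
    exact h.ne'
  · rw [max_eq_left (min_le_max.trans h.le), min_eq_right (h.le.trans min_le_max)]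
    exact h.ne'

theorem discordant_iff (u v : Fin 4 → ℝ) :
    Discordant u v ↔ u 1 ≠ u 2 ∧ DiscordantValues (v 0) (v 1) (v 2) (v 3) := by
  rw [Discordant, inseparable_iff, not_or, DiscordantValues, and_assoc]

theorem overcounted_iff (u v : Fin 4 → ℝ) :
    Overcounted u v ↔ u 1 ≠ u 2 ∧ OvercountedValues (v 0) (v 1) (v 2) (v 3) := Iff.rfl

theorem ConcordantValues.swap_left {a b c d : ℝ} (h : ConcordantValues a b c d) :
    ConcordantValues b a c d := by
  rwa [ConcordantValues, max_comm b, min_comm b]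

theorem ConcordantValues.swap_right {a b c d : ℝ} (h : ConcordantValues a b c d) :
    ConcordantValues a b d c := by
  rwa [ConcordantValues, max_comm d, min_comm d]

theorem DiscordantValues.swap_left {a b c d : ℝ} (h : DiscordantValues a b c d) :
    DiscordantValues b a c d := by
  rwa [DiscordantValues, max_comm b, min_comm b]

theorem DiscordantValues.swap_right {a b c d : ℝ} (h : DiscordantValues a b c d) :
    DiscordantValues a b d c := by
  rwa [DiscordantValues, max_comm d, min_comm d]

theorem OvercountedValues.swap_left {a b c d : ℝ} (h : OvercountedValues a b c d) :
    OvercountedValues b a c d := by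
  obtain ⟨rfl, h⟩ := h
  exact ⟨rfl, h⟩

theorem OvercountedValues.swap_right {a b c d : ℝ} (h : OvercountedValues a b c d) :
    OvercountedValues a b d c := by
  rwa [OvercountedValues, max_comm d, min_comm d]

/-! ### The values of the two passes in terms of quadruples -/

section
variable {P : (Fin 4 → ℝ) → (Fin 4 → ℝ) → Prop} {Q : ℝ → ℝ → ℝ → ℝ → Prop}
  (hP : ∀ u v : Fin 4 → ℝ, P u v ↔ u 1 ≠ u 2 ∧ Q (v 0) (v 1) (v 2) (v 3))
  (hl : ∀ a b c d, Q a b c d → Q b a c d) (hr : ∀ a b c d, Q a b c d → Q a b d c)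
include hP hl hr

open Classical in
-- Being strictly left of `p` implies being strictly left of `q`, so the tree has to be kept apart
-- from `p` only.
theorem quadIndicator_ascending {a b p q : ℝ × ℝ} (hap : a.1 ≤ p.1) (hbp : b.1 ≤ p.1)
    (hpq : p.1 ≤ q.1) :
    quadIndicator P (q ::ₘ p ::ₘ {a, b}) =
      if a.1 ≠ p.1 ∧ b.1 ≠ p.1 ∧ Q a.2 b.2 p.2 q.2 then 1 else 0 := by
  have e : q ::ₘ p ::ₘ {a, b} = ({a, b, p, q} : Multiset (ℝ × ℝ)) := by
    simp only [Multiset.insert_eq_cons, ← Multiset.cons_zero]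
    rw [Multiset.cons_swap q p, Multiset.cons_swap q a, Multiset.cons_swap q b,
      Multiset.cons_swap p a, Multiset.cons_swap p b]
  refine if_congr ?_ rfl rfl
  rw [e, quad_iff hP hl hr hap (hap.trans hpq) hbp (hbp.trans hpq)]
  constructor
  · rintro ⟨⟨h₁, -, h₂, -⟩, h⟩
    exact ⟨h₁, h₂, h⟩
  · rintro ⟨h₁, h₂, h⟩
    exact ⟨⟨h₁, ((lt_of_le_of_ne hap h₁).trans_le hpq).ne, h₂,
      ((lt_of_le_of_ne hbp h₂).trans_le hpq).ne⟩, h⟩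

open Classical in
theorem quadIndicator_descending {a b p q : ℝ × ℝ} (hap : p.1 ≤ a.1) (hbp : p.1 ≤ b.1)
    (hpq : q.1 ≤ p.1) :
    quadIndicator P (q ::ₘ p ::ₘ {a, b}) =
      if a.1 ≠ p.1 ∧ b.1 ≠ p.1 ∧ Q p.2 q.2 a.2 b.2 then 1 else 0 := by
  refine if_congr ?_ rfl rfl
  rw [Multiset.cons_swap]
  refine (quad_iff hP hl hr hap hbp (hpq.trans hap) (hpq.trans hbp)).trans ?_
  constructor
  · rintro ⟨⟨h₁, h₂, -⟩, h⟩
    exact ⟨h₁.symm, h₂.symm, h⟩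
  · rintro ⟨h₁, h₂, h⟩
    exact ⟨⟨h₁.symm, h₂.symm, (hpq.trans_lt (lt_of_le_of_ne hap h₁.symm)).ne,
      (hpq.trans_lt (lt_of_le_of_ne hbp h₂.symm)).ne⟩, h⟩

end

theorem sumPairs_concordantCount {l : List (ℝ × ℝ)} (hl : l.Pairwise fun p q => p.1 ≤ q.1) :
    sumPairs (fun pre p q => concordantCount (keysApart p.1 pre) p.2 q.2) l 0 =
      ((Multiset.powersetCard 4 (l : Multiset (ℝ × ℝ))).map (quadIndicator Concordant)).sum := by
  rw [sum_powersetCard_four]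
  refine (sumPairs_congr (R := fun p q => p.1 ≤ q.1) (fun pre p q h hpq => ?_) l hl 0
    (by simp)).symm
  refine sum_powersetCard_two _ p.1 (fun b a => ConcordantValues b a p.2 q.2)
    (fun K => concordantCount K p.2 q.2) (by simp [concordantCount])
    (fun b K => ?_) pre fun a ha b hb => ?_
  · convert concordantCount_cons p.2 q.2 b K
  · exact quadIndicator_ascending concordant_iff (fun _ _ _ _ => ConcordantValues.swap_left)
      (fun _ _ _ _ => ConcordantValues.swap_right) (h a ha).1 (h b hb).1 hpq

theorem sumPairs_discordantCount {l : List (ℝ × ℝ)} (hl : l.Pairwise fun p q => p.1 ≤ q.1) :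
    sumPairs (fun pre p q => discordantCount (keysApart p.1 pre) p.2 q.2) l 0 =
      ((Multiset.powersetCard 4 (l : Multiset (ℝ × ℝ))).map (quadIndicator Discordant)).sum +
      ((Multiset.powersetCard 4 (l : Multiset (ℝ × ℝ))).map (quadIndicator Overcounted)).sum := by
  rw [← Multiset.sum_map_add, sum_powersetCard_four]
  refine (sumPairs_congr (R := fun p q => p.1 ≤ q.1) (fun pre p q h hpq => ?_) l hl 0
    (by simp)).symm
  refine sum_powersetCard_two
    (fun T => quadIndicator Discordant (q ::ₘ p ::ₘ T) + quadIndicator Overcounted (q ::ₘ p ::ₘ T))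
    p.1 (fun b a => p.2 ≠ q.2 ∧ min p.2 q.2 < max b a ∧ min b a < max p.2 q.2)
    (fun K => discordantCount K p.2 q.2) (by simp [discordantCount])
    (fun b K => ?_) pre fun a ha b hb => ?_
  · convert discordantCount_cons p.2 q.2 b K
  · rw [quadIndicator_ascending discordant_iff (fun _ _ _ _ => DiscordantValues.swap_left)
      (fun _ _ _ _ => DiscordantValues.swap_right) (h a ha).1 (h b hb).1 hpq,
      quadIndicator_ascending overcounted_iff (fun _ _ _ _ => OvercountedValues.swap_left)
      (fun _ _ _ _ => OvercountedValues.swap_right) (h a ha).1 (h b hb).1 hpq]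
    have h₁ := discordantValues_or_overcountedValues a.2 b.2 p.2 q.2
    have h₂ := not_discordantValues_and_overcountedValues a.2 b.2 p.2 q.2
    -- As the two properties exclude each other, their indicators add up to the indicator of the
    -- test in the first pass.
    split_ifs <;> first | rfl | (exfalso; tauto)

theorem sumPairs_overcountedCount {l : List (ℝ × ℝ)} (hl : l.Pairwise fun p q => p.1 ≤ q.1) :
    sumPairs (fun pre p q => overcountedCount (keysApart p.1 pre) p.2 q.2) l.reverse 0 =
      ((Multiset.powersetCard 4 (l : Multiset (ℝ × ℝ))).map (quadIndicator Overcounted)).sum := by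
  -- Reversal leaves the four-subsets unchanged but makes `p`, `q` the two leftmost points.
  rw [← Multiset.coe_reverse l, sum_powersetCard_four]
  refine (sumPairs_congr (R := fun p q => q.1 ≤ p.1) (fun pre p q h hpq => ?_) l.reverse
    (List.pairwise_reverse.2 hl) 0 (by simp)).symm
  refine sum_powersetCard_two _ p.1 (fun b a => OvercountedValues p.2 q.2 b a)
    (fun K => overcountedCount K p.2 q.2) (by simp [overcountedCount])
    (fun b K => ?_) pre fun a ha b hb => ?_
  · convert overcountedCount_cons p.2 q.2 b K
  · exact quadIndicator_descending overcounted_iff (fun _ _ _ _ => OvercountedValues.swap_left)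
      (fun _ _ _ _ => OvercountedValues.swap_right) (h a ha).1 (h b hb).1 hpq

theorem val_firstPass_sortPoints {n : ℕ} (x y : Fin n → ℝ) :
    (firstPass (sortPoints (points x y)).val).val =
      ((numQuadruples Concordant x y : ℤ),
        (numQuadruples Discordant x y : ℤ) + (numQuadruples Overcounted x y : ℤ)) := by
  have h := pairwise_sortPoints (points x y)
  have e := Multiset.coe_eq_coe.2 (sortPoints_perm (points x y))
  rw [val_firstPass _ h, sumPairs_concordantCount h, sumPairs_discordantCount h, e,
    ← numQuadruples_eq_sum, ← numQuadruples_eq_sum, ← numQuadruples_eq_sum, Nat.cast_add]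

theorem val_secondPass_sortPoints {n : ℕ} (x y : Fin n → ℝ) (dis : ℤ) :
    (secondPass (sortPoints (points x y)).val dis).val =
      dis - (numQuadruples Overcounted x y : ℤ) := by
  have h := pairwise_sortPoints (points x y)
  have e := Multiset.coe_eq_coe.2 (sortPoints_perm (points x y))
  rw [val_secondPass _ h, sumPairs_overcountedCount h, e, ← numQuadruples_eq_sum]

/-! ### The statistic in terms of quadruples -/

theorem exists_labels {n : ℕ} (x : Fin n → ℝ) {S : Finset (Fin n)} (hS : S.card = 4) :
    ∃ e : Fin 4 ↪ Fin n, Labels x S e := by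
  let f := S.orderEmbOfFin hS
  let σ := Tuple.sort (x ∘ f)
  have hm : Monotone ((x ∘ f) ∘ σ) := Tuple.monotone_sort _
  refine ⟨σ.toEmbedding.trans f.toEmbedding, ?_, hm (by decide), hm (by decide), hm (by decide)⟩
  rw [← Finset.map_map, Finset.map_univ_equiv]
  exact Finset.map_orderEmbOfFin_univ S hS

/-- Embeddings with the same image differ by a unique permutation of the domain. -/
theorem sum_embeddings_eq_sum_perm {n : ℕ} (F : (Fin 4 ↪ Fin n) → ℝ) (e : Fin 4 ↪ Fin n) :
    ∑ f : Fin 4 ↪ Fin n with Finset.univ.map f = Finset.univ.map e, F f =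
      ∑ π : Equiv.Perm (Fin 4), F (π.toEmbedding.trans e) := by
  symm
  refine Finset.sum_bij (fun π _ => π.toEmbedding.trans e) ?_ ?_ ?_ fun _ _ => rfl
  · intro π _
    rw [Finset.mem_filter_univ, ← Finset.map_map, Finset.map_univ_equiv]
  · intro π _ σ _ h
    ext1 i
    exact e.injective (DFunLike.congr_fun h i)
  · intro f hf
    rw [Finset.mem_filter_univ] at hf
    have : ∀ i, ∃ j, e j = f i := fun i => by
      have : f i ∈ Finset.univ.map e := hf ▸ Finset.mem_map_of_mem f (Finset.mem_univ i)
      simpa using this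
    choose g hg using this
    have hinj : Function.Injective g := fun i j h => f.injective (by rw [← hg, ← hg, h])
    refine ⟨Equiv.ofBijective g (Finite.injective_iff_bijective.1 hinj), Finset.mem_univ _, ?_⟩
    ext1 i
    exact hg i

open Classical in
theorem quadIndicator_of_labels {P : (Fin 4 → ℝ) → (Fin 4 → ℝ) → Prop}
    {Q : ℝ → ℝ → ℝ → ℝ → Prop}
    (hP : ∀ u v : Fin 4 → ℝ, P u v ↔ u 1 ≠ u 2 ∧ Q (v 0) (v 1) (v 2) (v 3))
    (hl : ∀ a b c d, Q a b c d → Q b a c d) (hr : ∀ a b c d, Q a b c d → Q a b d c)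
    {n : ℕ} (x y : Fin n → ℝ) {S : Finset (Fin n)} {e : Fin 4 ↪ Fin n} (h : Labels x S e) :
    quadIndicator P (S.val.map fun i => (x i, y i)) =
      if x (e 1) ≠ x (e 2) ∧ Q (y (e 0)) (y (e 1)) (y (e 2)) (y (e 3)) then 1 else 0 := by
  obtain ⟨rfl, h₁, h₂, h₃⟩ := h
  refine if_congr ?_ rfl rfl
  rw [map_univ_val_fin_four]
  refine (quad_iff hP hl hr (a := (x (e 0), y (e 0))) (b := (x (e 1), y (e 1)))
    (c := (x (e 2), y (e 2))) (d := (x (e 3), y (e 3)))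
    (h₁.trans h₂) ((h₁.trans h₂).trans h₃) h₂ (h₂.trans h₃)).trans ?_
  refine and_congr_left fun _ => ⟨fun h => h.2.2.1, fun h => ?_⟩
  have h := lt_of_le_of_ne h₂ h
  exact ⟨(h₁.trans_lt h).ne, ((h₁.trans_lt h).trans_le h₃).ne, h.ne, (h.trans_le h₃).ne⟩

/-- The weights are those of `-8 * (D - 2 * C)` for the two indicators; the sign of the middle gap
is 1 or 0 because the labelling ascends. -/
theorem sum_embeddings_of_labels {n : ℕ} (x y : Fin n → ℝ) {S : Finset (Fin n)}
    (hS : S.card = 4) :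
    ∑ f : Fin 4 ↪ Fin n with Finset.univ.map f = S,
      a (x (f 0)) (x (f 1)) (x (f 2)) (x (f 3)) * a (y (f 0)) (y (f 1)) (y (f 2)) (y (f 3)) =
    16 * (quadIndicator Concordant (S.val.map fun i => (x i, y i)) : ℝ) -
      8 * (quadIndicator Discordant (S.val.map fun i => (x i, y i)) : ℝ) := by
  classical
  obtain ⟨e, he⟩ := exists_labels x hS
  rw [quadIndicator_of_labels concordant_iff (fun _ _ _ _ => ConcordantValues.swap_left)
      (fun _ _ _ _ => ConcordantValues.swap_right) x y he,
    quadIndicator_of_labels discordant_iff (fun _ _ _ _ => DiscordantValues.swap_left)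
      (fun _ _ _ _ => DiscordantValues.swap_right) x y he]
  obtain ⟨rfl, h₁, h₂, h₃⟩ := he
  rw [sum_embeddings_eq_sum_perm]
  refine (sum_perm_a_mul_a (x ∘ e) (y ∘ e) h₁ h₂ h₃).trans ?_
  simp only [Function.comp_apply, pairingSign_eq]
  obtain h | h := h₂.eq_or_lt
  · simp [h]
  · rw [Real.sign_of_pos (sub_pos.2 h)]
    simp only [ne_eq, h.ne, not_false_iff, true_and, Nat.cast_ite, Nat.cast_one, Nat.cast_zero]
    ring

theorem tStar_eq {n : ℕ} (x y : Fin n → ℝ) :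
    tStar x y = ((n - 4).factorial : ℝ) / (n.factorial : ℝ) *
      (16 * (numQuadruples Concordant x y : ℝ) - 8 * (numQuadruples Discordant x y : ℝ)) := by
  rw [tStar, numQuadruples_eq_sum, numQuadruples_eq_sum, ← sum_powersetCard_points,
    ← sum_powersetCard_points, Nat.cast_sum, Nat.cast_sum]
  congr 1
  -- The embeddings are grouped by their image, a four-element set.
  rw [Finset.mul_sum, Finset.mul_sum, ← Finset.sum_sub_distrib, ← Finset.sum_fiberwise_of_maps_to (s := Finset.univ)
    (t := Finset.powersetCard 4 Finset.univ) (g := fun f : Fin 4 ↪ Fin n => Finset.univ.map f)]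
  · exact Finset.sum_congr rfl fun S hS =>
      sum_embeddings_of_labels x y (Finset.mem_powersetCard.1 hS).2
  · intro f _
    rw [Finset.mem_powersetCard]
    simp

theorem factorial_div_factorial {n : ℕ} (hn : 4 ≤ n) :
    ((n - 4).factorial : ℝ) / (n.factorial : ℝ) = 1 / (n * (n - 1) * (n - 2) * (n - 3)) := by
  obtain ⟨m, rfl⟩ := Nat.exists_eq_add_of_le' hn
  have : (m.factorial : ℝ) ≠ 0 := by positivity
  rw [Nat.add_sub_cancel]
  simp only [Nat.factorial_succ]
  push_cast
  have h₁ : (m : ℝ) + 3 + 1 ≠ 0 := by positivity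
  have h₂ : (m : ℝ) + 2 + 1 ≠ 0 := by positivity
  have h₃ : (m : ℝ) + 1 + 1 ≠ 0 := by positivity
  have h₄ : (m : ℝ) + 1 ≠ 0 := by positivity
  rw [show (m : ℝ) + 4 - 1 = m + 2 + 1 by ring, show (m : ℝ) + 4 - 2 = m + 1 + 1 by ring,
    show (m : ℝ) + 4 - 3 = m + 1 by ring, show (m : ℝ) + 4 = m + 3 + 1 by ring]
  field_simp

theorem val_algorithm {n : ℕ} (hn : 4 ≤ n) (x y : Fin n → ℝ) :
    (algorithm (points x y)).val = tStar x y := by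
  have hlen : (points x y).length = n := List.length_ofFn
  rw [tStar_eq, factorial_div_factorial hn]
  simp only [algorithm, val_bind, val_length, hlen, val_firstPass_sortPoints,
    val_secondPass_sortPoints, combine, val_mul, val_div, val_sub, val_natToReal, val_intToReal]
  push_cast
  ring

end TauStar

theorem mainTheorem1 :
    (∀ (n : ℕ) (x y : Fin n → ℝ), 4 ≤ n →
      (TauStar.algorithm (TauStar.points x y)).val = TauStar.tStar x y) ∧
    (∃ C : ℝ, ∀ (n : ℕ) (x y : Fin n → ℝ), 2 ≤ n →
      ((TauStar.algorithm (TauStar.points x y)).cost : ℝ) ≤ C * ((n : ℝ) ^ 2 * Real.log n)) ∧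
    (∀ (n : ℕ) (x y : Fin n → ℝ),
      (TauStar.firstPass (TauStar.sortPoints (TauStar.points x y)).val).val =
        ((TauStar.numQuadruples TauStar.Concordant x y : ℤ),
          (TauStar.numQuadruples TauStar.Discordant x y : ℤ) +
            (TauStar.numQuadruples TauStar.Overcounted x y : ℤ))) ∧
    (∀ (n : ℕ) (x y : Fin n → ℝ) (dis : ℤ),
      (TauStar.secondPass (TauStar.sortPoints (TauStar.points x y)).val dis).val =
        dis - (TauStar.numQuadruples TauStar.Overcounted x y : ℤ)) :=
  ⟨fun _ x y hn => TauStar.val_algorithm hn x y,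
    ⟨3000, fun _ x y hn => TauStar.cost_algorithm_points_le hn x y⟩,
    fun _ x y => TauStar.val_firstPass_sortPoints x y,
    fun _ x y dis => TauStar.val_secondPass_sortPoints x y dis⟩
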